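/- Consider a $K$-armed bandit over rounds $t=1,\dots,T$, $T\ge 2$. In round $t$ arm $a$ has a true reward $X_t(a)\in[0,1]$ with mean $\mu_t(a)$; the reward vectors $X_t=(X_t(1),\dots,X_t(K))$ are independent over time, $X_t$ being independent of all information available before round $t$. Let $\mu_t^*=\max_a\mu_t(a)$, and let $\beta_T\ge 1$ be the number of breakpoints, i.e. of rounds $1\le t<T$ for which some arm has different reward distributions in rounds $t$ and $t+1$. Let $f_t:\mathbb R\to\mathbb R$ be non-decreasing drift functions with $f_t(0)=0$ that are Lipschitz with constants at most $l$. In each round $t$ an arm $a_t$ is pulled and a reward $r_t$ is observed. For a window length $\tau\in\mathbb N$ let $N_t(\tau,a)$ be the number of rounds $s\ge 1$ with $t-\tau\le s\le t-1$ and $a_s=a$, let $\bar X_t(\tau,a)$ be the average of the observed rewards $r_s$ over these rounds ($0$ if there are none), and let $c_t(\tau,a)=\sqrt{\xi\log(\min(t,\tau))/N_t(\tau,a)}$, where $\xi>1/2$. The principal uses Sliding-Window UCB: $a_t$ is the $t$-th arm for $t\le K$, and for $t>K$ the arm $a_t$ maximizes $\bar X_t(\tau,a)+c_t(\tau,a)$,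 which is read as $+\infty$ if $N_t(\tau,a)=0$; ties are broken arbitrarily, and $a_t$ depends only on information available before round $t$. With a greedy arm $g_t\in\arg\max_a\bar X_t(\tau,a)$, the agent is paid $\chi_t=\bar X_t(\tau,g_t)-\bar X_t(\tau,a_t)$ if $a_t\ne g_t$, and the observed reward is then $r_t=X_t(a_t)+f_t(\chi_t)$; if $a_t=g_t$, it is $r_t=X_t(a_t)$. Let $N_T(a)$ be the number of rounds $t\le T$ with $a_t=a$ and $\mu_t(a)<\mu_t^*$, and let $R_T=\sum_{t=1}^T(\mu_t^*-X_t(a_t))$. For all $K$, $\xi>1/2$, $l\ge 0$, $\Delta>0$ and $0<c_1\le c_2$ there is a constant $\tilde\eta>0$, depending only on these, such that for all such problems and all window lengths $\tau$ with $$c_1\sqrt{T\log T/\beta_T}\le\tau\le c_2\sqrt{T\log T/\beta_T}$$ the following holds. 1. For every arm $a$ such that $\mu_t^*-\mu_t(a)\ge\Delta$ in all rounds $t\le T$ with $\mu_t(a)<\mu_t^*$, $$\mathbb E[N_T(a)]\le\tilde\eta\sqrt{\beta_T\,T\log T}.$$ 2. If this gap condition holds for every arm, then $$\mathbb E[R_T]\le\tilde\eta\sqrt{\beta_T\,T\log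 T},$$ so that for bounded $\beta_T$ the expected regret is $\tilde O(\sqrt T)$. -/

import Mathlib

open MeasureTheory ProbabilityTheory
open scoped NNReal

namespace IncentivizedBandit

noncomputable section

/-! ### Sliding-window statistics along one trajectory

Rounds are numbered `1, 2, …`. A trajectory is given by the pulled arms `arm s` and the
observed (drift-contaminated) rewards `r s`. Whatever is computed in round `t` uses the last `τ`
completed rounds `t - τ, …, t - 1` (only those that are at least `1`). -/

/-- The rounds among the last `τ` rounds before round `t` in which arm `b` was pulled. -/
def windowPulls {K : ℕ} (τ : ℕ) (arm : ℕ → Fin K) (t : ℕ) (b : Fin K) : Finset ℕ :=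
  (Finset.Ico (max 1 (t - τ)) t).filter (fun s => arm s = b)

/-- `N_t(τ, b)`: the number of pulls of arm `b` within the window. -/
def windowCount {K : ℕ} (τ : ℕ) (arm : ℕ → Fin K) (t : ℕ) (b : Fin K) : ℕ :=
  (windowPulls τ arm t b).card

/-- `X̄_t(τ, b)`: the average observed reward of arm `b` within the window
(it is `0` if the arm was not pulled there). -/
def windowMean {K : ℕ} (τ : ℕ) (arm : ℕ → Fin K) (r : ℕ → ℝ) (t : ℕ) (b : Fin K) : ℝ :=
  (∑ s ∈ windowPulls τ arm t b, r s) / (windowCount τ arm t b : ℝ)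

/-- `c_t(τ, b) = √(ξ log (min t τ) / N_t(τ, b))`: the confidence radius. -/
def confRadius {K : ℕ} (ξ : ℝ) (τ : ℕ) (arm : ℕ → Fin K) (t : ℕ) (b : Fin K) : ℝ :=
  Real.sqrt (ξ * Real.log ((min t τ : ℕ) : ℝ) / (windowCount τ arm t b : ℝ))

/-- The upper confidence bound `X̄_t(τ, b) + c_t(τ, b)`, which is `+∞` for an arm that was not
pulled within the window. -/
def ucbIndex {K : ℕ} (ξ : ℝ) (τ : ℕ) (arm : ℕ → Fin K) (r : ℕ → ℝ) (t : ℕ) (b : Fin K) : EReal :=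
  if windowCount τ arm t b = 0 then ⊤
  else ((windowMean τ arm r t b + confRadius ξ τ arm t b : ℝ) : EReal)

/-- A trajectory, up to round `T`, of incentivized exploration under reward drift in which the
principal recommends arms by Sliding-Window UCB. Here `f t` is the drift function of round `t`,
`x t b` is the true reward of arm `b` in round `t`, `arm t` is the recommended (and pulled) arm,
`greedy t` the greedy arm and `r t` the observed reward. Ties are broken arbitrarily. -/
structure IsTrajectory {K : ℕ} (ξ : ℝ) (τ T : ℕ) (f : ℕ → ℝ → ℝ) (x : ℕ → Fin K → ℝ)
    (arm greedy : ℕ → Fin K) (r : ℕ → ℝ) : Prop where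
  /-- In the first `K` rounds every arm is pulled once, in order. -/
  init : ∀ t, 1 ≤ t → t ≤ T → t ≤ K → (arm t : ℕ) + 1 = t
  /-- Afterwards the recommended arm maximizes the upper confidence bound. -/
  select : ∀ t, K < t → t ≤ T → ∀ b, ucbIndex ξ τ arm r t b ≤ ucbIndex ξ τ arm r t (arm t)
  /-- The greedy arm maximizes the empirical average. -/
  greedy_max : ∀ t, 1 ≤ t → t ≤ T → ∀ b, windowMean τ arm r t b ≤ windowMean τ arm r t (greedy t)
  /-- If the two arms differ, the agent is paid the difference of the empirical averages, and the
  observed reward is the true reward plus the drift caused by the payment. -/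
  reward : ∀ t, 1 ≤ t → t ≤ T → r t =
    if arm t ≠ greedy t then
      x t (arm t) + f t (windowMean τ arm r t (greedy t) - windowMean τ arm r t (arm t))
    else x t (arm t)

/-! ### The stochastic environment -/

/-- The reward drift functions of rounds `1, …, T` are non-decreasing, vanish at `0` and are
Lipschitz with constants at most `l`. -/
def IsDrift (l : ℝ≥0) (T : ℕ) (f : ℕ → ℝ → ℝ) : Prop :=
  ∀ t, 1 ≤ t → t ≤ T → Monotone (f t) ∧ f t 0 = 0 ∧ LipschitzWith l (f t)

/-- Rewards with values in `[0, 1]`, independent over time: the reward vector of round `t` is known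
after round `t` and independent of the information `ℱ (t - 1)` available before. The rewards of
different arms in the same round may be dependent. -/
structure IsEnvironment {Ω : Type*} [m : MeasurableSpace Ω] {K : ℕ} (P : Measure Ω)
    (ℱ : Filtration ℕ m) (T : ℕ) (X : ℕ → Ω → Fin K → ℝ) : Prop where
  adapted : ∀ t, 1 ≤ t → t ≤ T → Measurable[ℱ t] (X t)
  indep : ∀ t, 1 ≤ t → t ≤ T →
    Indep (MeasurableSpace.comap (X t) inferInstance) (ℱ (t - 1)) P
  mem_Icc : ∀ t, 1 ≤ t → t ≤ T → ∀ ω a, X t ω a ∈ Set.Icc (0 : ℝ) 1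

/-- `μ_t(a)`, the expected reward of arm `a` in round `t`. -/
def meanReward {Ω : Type*} [MeasurableSpace Ω] {K : ℕ} (P : Measure Ω)
    (X : ℕ → Ω → Fin K → ℝ) (t : ℕ) (a : Fin K) : ℝ :=
  ∫ ω, X t ω a ∂P

/-- `μ_t^*`, the highest expected reward in round `t`. -/
def bestMean {Ω : Type*} [MeasurableSpace Ω] {K : ℕ} (P : Measure Ω)
    (X : ℕ → Ω → Fin K → ℝ) (t : ℕ) : ℝ :=
  ⨆ a : Fin K, meanReward P X t a

open Classical in
/-- `β_T`: the number of rounds `1 ≤ t < T` after which the reward distribution of some arm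
changes. -/
def numBreakpoints {Ω : Type*} [MeasurableSpace Ω] {K : ℕ} (P : Measure Ω)
    (X : ℕ → Ω → Fin K → ℝ) (T : ℕ) : ℕ :=
  ((Finset.Ico 1 T).filter (fun t =>
    ∃ a : Fin K, P.map (fun ω => X t ω a) ≠ P.map (fun ω => X (t + 1) ω a))).card

/-- Whenever arm `a` is suboptimal during the rounds `1, …, T`, it is so by at least `Δ`. -/
def HasGap {Ω : Type*} [MeasurableSpace Ω] {K : ℕ} (P : Measure Ω)
    (X : ℕ → Ω → Fin K → ℝ) (T : ℕ) (Δ : ℝ) (a : Fin K) : Prop :=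
  ∀ t, 1 ≤ t → t ≤ T → meanReward P X t a < bestMean P X t →
    Δ ≤ bestMean P X t - meanReward P X t a

open Classical in
/-- `N_T(a)`: the number of rounds `1 ≤ t ≤ T` in which arm `a` is pulled while suboptimal. -/
def suboptimalPulls {Ω : Type*} [MeasurableSpace Ω] {K : ℕ} (P : Measure Ω)
    (X : ℕ → Ω → Fin K → ℝ) (T : ℕ) (arm : ℕ → Ω → Fin K) (a : Fin K) (ω : Ω) : ℕ :=
  ((Finset.Icc 1 T).filter (fun t =>
    arm t ω = a ∧ meanReward P X t a < bestMean P X t)).card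

/-- `R_T = ∑_{t ≤ T} (μ_t^* - X_t(a_t))`. -/
def regret {Ω : Type*} [MeasurableSpace Ω] {K : ℕ} (P : Measure Ω)
    (X : ℕ → Ω → Fin K → ℝ) (T : ℕ) (arm : ℕ → Ω → Fin K) (ω : Ω) : ℝ :=
  ∑ t ∈ Finset.Icc 1 T, (bestMean P X t - X t ω (arm t ω))

end

end IncentivizedBandit

/-! Write L = √(ξ log τ) and Q = √(β T log T).

Drift is harmless because the selection rule limits its own payments: the pulled arm has the largest
index, so its payment is at most its own confidence radius (`IsTrajectory.payment_le_confRadius`). A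
pull of rank i ≥ 1 in the window therefore adds drift at most l L/√i. These terms sum to O(l L √n)
over n pulls, so drift shifts an average by O(l L/√n), the order of the confidence radius itself
(`IsTrajectory.windowMean_le_trueMean`). Drift is never negative, so it cannot make a good arm look
worse.

This fails for an arm absent from its window, whose index is +∞. Once τ exceeds a constant, no arm
is ever absent (`IsTrajectory.one_le_windowCount`): scarcity of one arm forces any arm pulled
instead to be scarce too, and repeating this K times would leave too few pulls to fill the window.

Hence, in a window with constant means, a suboptimal arm with at least A ≈ const · log τ / Δ² pulls
is pulled again only if true rewards deviate from their means (`IsTrajectory.deviation`). The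
numbers of pulls are random, so deviations are controlled by exponential supermartingales: each
parameter fails with probability at most 1/τ, and a geometric grid of O(log τ) parameters covers all
possible counts.

Suboptimal pulls thus number at most τ initially, βτ after breakpoints, A per block of τ rounds, and
O(T log τ / τ) in expectation from bad events. All of this is O(Q) for the prescribed τ. For τ below
the constant, T itself is O(Q). Regret follows because each gap is at most 1. -/

namespace IncentivizedBandit

/-! ### Elementary facts about window counts and sums -/

section Window

variable {K τ : ℕ} {arm : ℕ → Fin K} {t : ℕ} {b : Fin K}

lemma mem_windowPulls {s : ℕ} :
    s ∈ windowPulls τ arm t b ↔ (1 ≤ s ∧ t ≤ s + τ ∧ s < t) ∧ arm s = b := by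
  simp only [windowPulls, Finset.mem_filter, Finset.mem_Ico, max_le_iff]
  constructor <;> rintro ⟨h, rfl⟩ <;> exact ⟨by omega, rfl⟩

lemma windowCount_le : windowCount τ arm t b ≤ τ := by
  calc (windowPulls τ arm t b).card ≤ (Finset.Ico (t - τ) t).card := by
        apply Finset.card_le_card
        intro s hs
        rw [mem_windowPulls] at hs
        simp only [Finset.mem_Ico]; omega
    _ ≤ τ := by simp only [Nat.card_Ico]; omega

lemma sum_windowCount (ht : τ < t) : ∑ b, windowCount τ arm t b = τ := by
  have h := Finset.card_eq_sum_card_fiberwise (f := arm) (s := Finset.Ico (max 1 (t - τ)) t)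
    (t := Finset.univ) (fun _ _ => Finset.mem_coe.2 (Finset.mem_univ _))
  simp only [Nat.card_Ico] at h
  simp only [windowCount, windowPulls]
  omega

/-- Moving the window by `u - t` rounds changes a count by at most `u - t`. -/
lemma windowCount_le_add {u : ℕ} (htu : t ≤ u) :
    windowCount τ arm t b ≤ windowCount τ arm u b + (u - t) := by
  have hsub : windowPulls τ arm t b ⊆ windowPulls τ arm u b ∪ Finset.Ico (t - τ) (u - τ) := by
    intro s hs
    rw [mem_windowPulls] at hs
    rw [Finset.mem_union, mem_windowPulls, Finset.mem_Ico]
    by_cases h : u ≤ s + τ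
    · exact Or.inl ⟨by omega, hs.2⟩
    · right; omega
  refine (Finset.card_le_card hsub).trans ((Finset.card_union_le _ _).trans ?_)
  simp only [Nat.card_Ico, windowCount]
  omega

lemma windowCount_le_add' {u : ℕ} (htu : t ≤ u) :
    windowCount τ arm u b ≤ windowCount τ arm t b + (u - t) := by
  have hsub : windowPulls τ arm u b ⊆ windowPulls τ arm t b ∪ Finset.Ico t u := by
    intro s hs
    rw [mem_windowPulls] at hs
    rw [Finset.mem_union, mem_windowPulls, Finset.mem_Ico]
    by_cases h : s < t
    · exact Or.inl ⟨by omega, hs.2⟩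
    · right; omega
  refine (Finset.card_le_card hsub).trans ((Finset.card_union_le _ _).trans ?_)
  simp only [Nat.card_Ico, windowCount]
  omega

/-- The window of the earlier round s reaches back at least as far as that of t, so it contains
every pull of b that precedes s in the window of t. This turns confidence radii into bounds by rank.
-/
lemma rank_le_windowCount {s : ℕ} (hs : s ∈ windowPulls τ arm t b) :
    ((windowPulls τ arm t b).filter (· < s)).card ≤ windowCount τ arm s (arm s) := by
  apply Finset.card_le_card
  intro u hu
  rw [Finset.mem_filter, mem_windowPulls] at hu
  rw [mem_windowPulls] at hs
  rw [mem_windowPulls]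
  exact ⟨by omega, hu.1.2.trans hs.2.symm⟩

lemma windowMean_le {r : ℕ → ℝ} {C : ℝ} (hC : 0 ≤ C)
    (h : ∀ s, 1 ≤ s → s < t → r s ≤ C) : windowMean τ arm r t b ≤ C := by
  apply div_le_of_le_mul₀ (Nat.cast_nonneg _) hC
  have := Finset.sum_le_card_nsmul (windowPulls τ arm t b) r C fun s hs => by
    rw [mem_windowPulls] at hs; exact h s hs.1.1 hs.1.2.2
  rwa [nsmul_eq_mul, mul_comm] at this

lemma windowMean_nonneg {r : ℕ → ℝ} (h : ∀ s, 1 ≤ s → s < t → 0 ≤ r s) :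
    0 ≤ windowMean τ arm r t b := by
  refine div_nonneg (Finset.sum_nonneg fun s hs => ?_) (Nat.cast_nonneg _)
  rw [mem_windowPulls] at hs; exact h s hs.1.1 hs.1.2.2

lemma confRadius_le {ξ : ℝ} (hξ : 0 < ξ) (ht : 1 ≤ t) (hτ : 1 ≤ τ) :
    confRadius ξ τ arm t b ≤ √(ξ * Real.log τ) / √(windowCount τ arm t b) := by
  rw [confRadius, Real.sqrt_div' _ (Nat.cast_nonneg _)]
  have hle : Real.log ((min t τ : ℕ) : ℝ) ≤ Real.log τ := by
    apply Real.log_le_log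
    · exact_mod_cast (by omega : 0 < min t τ)
    · exact_mod_cast min_le_right t τ
  gcongr

end Window

/-- A weight bounded by a function of the rank within `S` sums up to at most the sum of that
function over all ranks. -/
lemma sum_le_sum_range_of_rank (S : Finset ℕ) (w g : ℕ → ℝ)
    (h : ∀ s ∈ S, w s ≤ g (S.filter (· < s)).card) :
    ∑ s ∈ S, w s ≤ ∑ i ∈ Finset.range S.card, g i := by
  induction S using Finset.induction_on_max with
  | empty => simp
  | insert a S ha ih =>
    have hnot : a ∉ S := fun h => lt_irrefl _ (ha a h)
    rw [Finset.sum_insert hnot, Finset.card_insert_of_notMem hnot, Finset.sum_range_succ, add_comm]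
    apply add_le_add
    · apply ih
      intro s hs
      have := h s (Finset.mem_insert_of_mem hs)
      rwa [Finset.filter_insert, if_neg (not_lt.2 (ha s hs).le)] at this
    · have := h a (Finset.mem_insert_self a S)
      rwa [Finset.filter_insert, if_neg (lt_irrefl a), Finset.filter_true_of_mem ha] at this

/-- Telescoping with 1/√(n+1) ≤ 2(√(n+1) − √n). Rank 0 gets a separate value D, since L/√0 would be
0 by convention. -/
lemma sum_range_inv_sqrt_le {L : ℝ} (hL : 0 ≤ L) (D : ℝ) (n : ℕ) :
    ∑ i ∈ Finset.range (n + 1), (if i = 0 then D else L / √i) ≤ D + 2 * L * √n := by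
  induction n with
  | zero => simp
  | succ n ih =>
    rw [Finset.sum_range_succ, if_neg (Nat.succ_ne_zero n)]
    have ha : 0 < √((n + 1 : ℕ) : ℝ) := Real.sqrt_pos.2 (by positivity)
    have ha2 : √((n + 1 : ℕ) : ℝ) ^ 2 = n + 1 := by
      rw [Real.sq_sqrt (by positivity)]; push_cast; ring
    have hb2 : √(n : ℝ) ^ 2 = n := Real.sq_sqrt (by positivity)
    have key : 1 / √((n + 1 : ℕ) : ℝ) ≤ 2 * (√((n + 1 : ℕ) : ℝ) - √n) := by
      rw [div_le_iff₀ ha]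
      nlinarith [sq_nonneg (√((n + 1 : ℕ) : ℝ) - √n)]
    have := mul_le_mul_of_nonneg_left key hL
    rw [mul_one_div] at this
    linarith

/-! ### Drift along one trajectory -/

section Trajectory

variable {K : ℕ} {ξ : ℝ} {τ T : ℕ} {f : ℕ → ℝ → ℝ} {x : ℕ → Fin K → ℝ}
  {arm greedy : ℕ → Fin K} {r : ℕ → ℝ} {l : ℝ≥0}

/-- The payment of round `t`; it vanishes if the greedy arm is pulled. -/
noncomputable def payment (τ : ℕ) (arm greedy : ℕ → Fin K) (r : ℕ → ℝ) (t : ℕ) : ℝ :=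
  windowMean τ arm r t (greedy t) - windowMean τ arm r t (arm t)

lemma IsTrajectory.payment_nonneg (h : IsTrajectory ξ τ T f x arm greedy r) {t : ℕ}
    (h1 : 1 ≤ t) (hT : t ≤ T) : 0 ≤ payment τ arm greedy r t :=
  sub_nonneg.2 (h.greedy_max t h1 hT _)

lemma IsTrajectory.reward_eq (h : IsTrajectory ξ τ T f x arm greedy r) (hf : IsDrift l T f)
    {t : ℕ} (h1 : 1 ≤ t) (hT : t ≤ T) :
    r t = x t (arm t) + f t (payment τ arm greedy r t) := by
  rw [h.reward t h1 hT]
  split_ifs with hag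
  · rfl
  · push Not at hag
    rw [payment, ← hag, sub_self, (hf t h1 hT).2.1, add_zero]

lemma IsTrajectory.reward_ge (h : IsTrajectory ξ τ T f x arm greedy r) (hf : IsDrift l T f)
    {t : ℕ} (h1 : 1 ≤ t) (hT : t ≤ T) : x t (arm t) ≤ r t := by
  rw [h.reward_eq hf h1 hT]
  have := (hf t h1 hT).1 (h.payment_nonneg h1 hT)
  rw [(hf t h1 hT).2.1] at this
  linarith

lemma IsTrajectory.reward_le (h : IsTrajectory ξ τ T f x arm greedy r) (hf : IsDrift l T f)
    {t : ℕ} (h1 : 1 ≤ t) (hT : t ≤ T) :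
    r t ≤ x t (arm t) + l * payment τ arm greedy r t := by
  rw [h.reward_eq hf h1 hT]
  have := (hf t h1 hT).2.2.dist_le_mul (payment τ arm greedy r t) 0
  rw [(hf t h1 hT).2.1, Real.dist_eq, Real.dist_eq, sub_zero, sub_zero,
    abs_of_nonneg (h.payment_nonneg h1 hT)] at this
  linarith [le_abs_self (f t (payment τ arm greedy r t))]

lemma IsTrajectory.reward_nonneg (h : IsTrajectory ξ τ T f x arm greedy r) (hf : IsDrift l T f)
    (hx : ∀ t, 1 ≤ t → t ≤ T → ∀ b, x t b ∈ Set.Icc (0 : ℝ) 1)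
    {t : ℕ} (h1 : 1 ≤ t) (hT : t ≤ T) : 0 ≤ r t :=
  (hx t h1 hT _).1.trans (h.reward_ge hf h1 hT)

lemma IsTrajectory.payment_le_of_reward_le (h : IsTrajectory ξ τ T f x arm greedy r)
    (hf : IsDrift l T f) (hx : ∀ t, 1 ≤ t → t ≤ T → ∀ b, x t b ∈ Set.Icc (0 : ℝ) 1)
    {t : ℕ} (hT : t ≤ T) {C : ℝ} (hC : 0 ≤ C) (hr : ∀ s, 1 ≤ s → s < t → r s ≤ C) :
    payment τ arm greedy r t ≤ C := by
  have h1 : windowMean τ arm r t (greedy t) ≤ C := windowMean_le hC hr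
  have h2 : 0 ≤ windowMean τ arm r t (arm t) :=
    windowMean_nonneg fun s h1 hs => h.reward_nonneg hf hx h1 (by omega)
  rw [payment]; linarith

/-- Observed rewards grow at most geometrically. -/
lemma IsTrajectory.reward_le_pow (h : IsTrajectory ξ τ T f x arm greedy r) (hf : IsDrift l T f)
    (hx : ∀ t, 1 ≤ t → t ≤ T → ∀ b, x t b ∈ Set.Icc (0 : ℝ) 1)
    {t : ℕ} (h1 : 1 ≤ t) (hT : t ≤ T) : r t ≤ (1 + l : ℝ) ^ t := by
  induction t using Nat.strong_induction_on with
  | _ t ih =>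
    obtain ⟨t, rfl⟩ : ∃ k, t = k + 1 := ⟨t - 1, by omega⟩
    have hl : (0 : ℝ) ≤ l := l.2
    have hp : payment τ arm greedy r (t + 1) ≤ (1 + l : ℝ) ^ t := by
      refine h.payment_le_of_reward_le hf hx hT (by positivity) fun s hs1 hs => ?_
      exact (ih s hs hs1 (by omega)).trans
        (pow_le_pow_right₀ (by linarith) (by omega))
    have hone : (1 : ℝ) ≤ (1 + l : ℝ) ^ t := one_le_pow₀ (by linarith)
    have := h.reward_le hf h1 hT
    have h3 := (hx (t + 1) h1 hT (arm (t + 1))).2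
    have h4 := mul_le_mul_of_nonneg_left hp hl
    rw [pow_succ]
    linarith

/-- The first K pulls are forced, so no index comparison limits their payments; a bound independent
of T and τ suffices. -/
lemma IsTrajectory.payment_le_init (h : IsTrajectory ξ τ T f x arm greedy r) (hf : IsDrift l T f)
    (hx : ∀ t, 1 ≤ t → t ≤ T → ∀ b, x t b ∈ Set.Icc (0 : ℝ) 1)
    {t : ℕ} (hT : t ≤ T) (hK : t ≤ K) : payment τ arm greedy r t ≤ (1 + l : ℝ) ^ K := by
  have hl : (0 : ℝ) ≤ l := l.2
  refine h.payment_le_of_reward_le hf hx hT (by positivity) fun s hs1 hs => ?_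
  exact (h.reward_le_pow hf hx hs1 (by omega)).trans
    (pow_le_pow_right₀ (by linarith) (by omega))

/-- The index comparison in real numbers, when the pulled arm occurs in the window. -/
lemma IsTrajectory.index_le (h : IsTrajectory ξ τ T f x arm greedy r) {t : ℕ} (hK : K < t)
    (hT : t ≤ T) (hc : 1 ≤ windowCount τ arm t (arm t)) (b : Fin K) :
    1 ≤ windowCount τ arm t b ∧
    windowMean τ arm r t b + confRadius ξ τ arm t b ≤
      windowMean τ arm r t (arm t) + confRadius ξ τ arm t (arm t) := by
  have := h.select t hK hT b
  rw [ucbIndex, ucbIndex, if_neg (by omega : ¬ windowCount τ arm t (arm t) = 0)] at this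
  split_ifs at this with hb
  · exact absurd (top_le_iff.1 this) (EReal.coe_ne_top _)
  · exact ⟨by omega, by exact_mod_cast this⟩

/-- Compare the indices of the pulled and the greedy arm and drop the nonnegative radius of the
latter. -/
lemma IsTrajectory.payment_le_confRadius (h : IsTrajectory ξ τ T f x arm greedy r) {t : ℕ}
    (hK : K < t) (hT : t ≤ T) (hc : 1 ≤ windowCount τ arm t (arm t)) :
    payment τ arm greedy r t ≤ confRadius ξ τ arm t (arm t) := by
  have h1 := (h.index_le hK hT hc (greedy t)).2
  have h2 : 0 ≤ confRadius ξ τ arm t (greedy t) := Real.sqrt_nonneg _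
  rw [payment]; linarith

/-- The average true reward within the window. -/
noncomputable def trueMean (τ : ℕ) (arm : ℕ → Fin K) (x : ℕ → Fin K → ℝ) (t : ℕ) (b : Fin K) : ℝ :=
  (∑ s ∈ windowPulls τ arm t b, x s b) / (windowCount τ arm t b : ℝ)

lemma IsTrajectory.trueMean_le_windowMean (h : IsTrajectory ξ τ T f x arm greedy r)
    (hf : IsDrift l T f) {t : ℕ} (hT : t ≤ T + 1) (b : Fin K) :
    trueMean τ arm x t b ≤ windowMean τ arm r t b := by
  refine div_le_div_of_nonneg_right (Finset.sum_le_sum fun s hs => ?_) (Nat.cast_nonneg _)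
  rw [mem_windowPulls] at hs
  rw [← hs.2]
  exact h.reward_ge hf hs.1.1 (by omega)

/-- As long as no pulled arm was missing from the window, drift contributes at most
`4 l √(ξ log τ / n)` to the average of `n` observed rewards. -/
lemma IsTrajectory.windowMean_le_trueMean (h : IsTrajectory ξ τ T f x arm greedy r)
    (hf : IsDrift l T f) (hx : ∀ t, 1 ≤ t → t ≤ T → ∀ b, x t b ∈ Set.Icc (0 : ℝ) 1)
    (hξ : 0 < ξ) (hτ : 1 ≤ τ) (hM : (1 + l : ℝ) ^ K ≤ √(ξ * Real.log τ))
    {t : ℕ} (hT : t ≤ T + 1) (hdrop : ∀ s, K < s → s < t → 1 ≤ windowCount τ arm s (arm s))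
    {b : Fin K} (hb : 1 ≤ windowCount τ arm t b) :
    windowMean τ arm r t b ≤
      trueMean τ arm x t b + 4 * l * √(ξ * Real.log τ) / √(windowCount τ arm t b) := by
  set L := √(ξ * Real.log τ) with hL
  set n := windowCount τ arm t b with hn
  have hL0 : 0 ≤ L := Real.sqrt_nonneg _
  have hl : (0 : ℝ) ≤ l := l.2
  have hpay : ∑ s ∈ windowPulls τ arm t b, payment τ arm greedy r s ≤
      ∑ i ∈ Finset.range n, (if i = 0 then 2 * L else L / √i) := by
    refine sum_le_sum_range_of_rank _ _ (fun i => if i = 0 then 2 * L else L / √i) fun s hs => ?_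
    have hs' := mem_windowPulls.1 hs
    rcases le_or_gt s K with hsK | hsK
    -- An initial round is the only one among the first K that pulls its arm, so it has rank 0 and
    -- its payment is absorbed by the separate value there.
    · have hrank : ((windowPulls τ arm t b).filter (· < s)).card = 0 := by
        rw [Finset.card_eq_zero, Finset.filter_eq_empty_iff]
        intro u hu hus
        rw [mem_windowPulls] at hu
        have h1 := h.init u hu.1.1 (by omega) (by omega)
        have h2 := h.init s hs'.1.1 (by omega) (by omega)
        rw [hu.2, ← hs'.2] at h1
        omega
      simp only [hrank, if_true]
      linarith [h.payment_le_init hf hx (t := s) (by omega) hsK]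
    · have hc := hdrop s hsK hs'.1.2.2
      have hp : payment τ arm greedy r s ≤ L / √(windowCount τ arm s (arm s)) :=
        (h.payment_le_confRadius hsK (by omega) hc).trans (confRadius_le hξ hs'.1.1 hτ)
      refine hp.trans ?_
      have hrk := rank_le_windowCount hs
      split_ifs with h0
      · have : L / √(windowCount τ arm s (arm s)) ≤ L := by
          apply div_le_self hL0
          rw [Real.one_le_sqrt]
          exact_mod_cast hc
        linarith
      · have h0' : 0 < ((windowPulls τ arm t b).filter (· < s)).card := by omega
        gcongr
  obtain ⟨k, hk⟩ : ∃ k, n = k + 1 := ⟨n - 1, by omega⟩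
  have hn1 : (1 : ℝ) ≤ n := by exact_mod_cast hb
  have hsq1 : 1 ≤ √(n : ℝ) := by rwa [Real.one_le_sqrt]
  have hpay2 : ∑ s ∈ windowPulls τ arm t b, payment τ arm greedy r s ≤ 4 * L * √n := by
    have h1 := hpay
    rw [hk] at h1
    have h2 := h1.trans (sum_range_inv_sqrt_le hL0 (2 * L) k)
    have h3 : √(k : ℝ) ≤ √(n : ℝ) := by
      apply Real.sqrt_le_sqrt; rw [hk]; push_cast; linarith
    nlinarith [mul_le_mul_of_nonneg_left h3 hL0, mul_le_mul_of_nonneg_left hsq1 hL0]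
  have hsum : ∑ s ∈ windowPulls τ arm t b, r s ≤
      ∑ s ∈ windowPulls τ arm t b, x s b + l * (4 * L * √n) := by
    calc ∑ s ∈ windowPulls τ arm t b, r s
        ≤ ∑ s ∈ windowPulls τ arm t b, (x s b + l * payment τ arm greedy r s) := by
          refine Finset.sum_le_sum fun s hs => ?_
          rw [mem_windowPulls] at hs
          rw [← hs.2]
          exact h.reward_le hf hs.1.1 (by omega)
      _ = ∑ s ∈ windowPulls τ arm t b, x s b +
            l * ∑ s ∈ windowPulls τ arm t b, payment τ arm greedy r s := by
          rw [Finset.sum_add_distrib, Finset.mul_sum]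
      _ ≤ _ := by gcongr
  have hdiv : 4 * l * L / √n = l * (4 * L * √n) / n := by
    have : (n : ℝ) = √n * √n := (Real.mul_self_sqrt (by positivity)).symm
    have h0 : √(n : ℝ) ≠ 0 := by positivity
    rw [eq_div_iff (by positivity), div_mul_eq_mul_div, div_eq_iff h0]
    nth_rewrite 1 [this]
    ring
  rw [hdiv, windowMean, trueMean, ← hn, ← add_div]
  gcongr

end Trajectory

/-! ### No arm leaves the window -/

/-- If an arm is missing from a long window, at least `k` arms have at most
`scarceCount G K k` pulls there. -/
def scarceCount (G K : ℕ) : ℕ → ℕ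
  | 0 => 0
  | k + 1 => G * (K * scarceCount G K k + 1)

lemma scarceCount_le_succ {G K : ℕ} (hG : 1 ≤ G) (hK : 1 ≤ K) (k : ℕ) :
    scarceCount G K k ≤ scarceCount G K (k + 1) := by
  calc scarceCount G K k ≤ K * scarceCount G K k := Nat.le_mul_of_pos_left _ hK
    _ ≤ K * scarceCount G K k + 1 := Nat.le_succ _
    _ ≤ G * (K * scarceCount G K k + 1) := Nat.le_mul_of_pos_left _ hG

section Trajectory

variable {K : ℕ} {ξ : ℝ} {τ T : ℕ} {f : ℕ → ℝ → ℝ} {x : ℕ → Fin K → ℝ}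
  {arm greedy : ℕ → Fin K} {r : ℕ → ℝ} {l : ℝ≥0}

lemma trueMean_le_one (hx : ∀ t, 1 ≤ t → t ≤ T → ∀ b, x t b ∈ Set.Icc (0 : ℝ) 1)
    {t : ℕ} (hT : t ≤ T + 1) (b : Fin K) : trueMean τ arm x t b ≤ 1 := by
  apply div_le_of_le_mul₀ (Nat.cast_nonneg _) zero_le_one
  have := Finset.sum_le_card_nsmul (windowPulls τ arm t b) (fun s => x s b) 1 fun s hs => by
    rw [mem_windowPulls] at hs; exact (hx s hs.1.1 (by omega) b).2
  rwa [nsmul_eq_mul, mul_comm] at this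

/-- If arm `a` has few pulls in the window, then so has the arm pulled instead. -/
lemma IsTrajectory.windowCount_pulled_le (h : IsTrajectory ξ τ T f x arm greedy r)
    (hf : IsDrift l T f) (hx : ∀ t, 1 ≤ t → t ≤ T → ∀ b, x t b ∈ Set.Icc (0 : ℝ) 1)
    (hξ : 0 < ξ) (hτ : 4 ≤ τ) (hM : (1 + l : ℝ) ^ K ≤ √(ξ * Real.log τ))
    {t m : ℕ} (hK : K < t) (hT : t ≤ T) (hτt : τ ≤ 2 * t)
    (hdrop : ∀ s, K < s → s ≤ t → ∀ b, 1 ≤ windowCount τ arm s b)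
    {a : Fin K} (ha : windowCount τ arm t a ≤ m) (hm : 4 * √m ≤ √(ξ * Real.log τ)) :
    (windowCount τ arm t (arm t) : ℝ) ≤ (4 * (4 * l + 1)) ^ 2 * m := by
  set L := √(ξ * Real.log τ) with hL
  have hl : (0 : ℝ) ≤ l := l.2
  have hL0 : 0 ≤ L := Real.sqrt_nonneg _
  set n := windowCount τ arm t (arm t) with hn
  have hn1 : 1 ≤ n := hdrop t hK le_rfl _
  have hna1 : 1 ≤ windowCount τ arm t a := hdrop t hK le_rfl _
  have hm1 : (1 : ℝ) ≤ m := by exact_mod_cast hna1.trans ha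
  have hsm : 0 < √(m : ℝ) := Real.sqrt_pos.2 (by linarith)
  have hsn : 0 < √(n : ℝ) := Real.sqrt_pos.2 (by exact_mod_cast hn1)
  have hLpos : 0 < L := by linarith
  have hidx := (h.index_le hK hT hn1 a).2
  have hmean := h.windowMean_le_trueMean hf hx hξ (by omega) hM (by omega)
    (fun s hs hst => hdrop s hs hst.le _) hn1
  have htrue := trueMean_le_one (τ := τ) (arm := arm) hx (t := t) (by omega) (arm t)
  have hconf : confRadius ξ τ arm t (arm t) ≤ L / √n := confRadius_le hξ (by omega) (by omega)
  have h0 : 0 ≤ windowMean τ arm r t a :=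
    windowMean_nonneg fun s h1 hs => h.reward_nonneg hf hx h1 (by omega)
  have hlow : L / 2 / √m ≤ confRadius ξ τ arm t a := by
    -- The logarithm may be of t instead of τ, but t ≥ τ/2. The factor 1/4 is a convenient loss: its
    -- square root is the 1/2 in `hlow`.
    have hmin : (1 / 4 : ℝ) * Real.log τ ≤ Real.log ((min t τ : ℕ) : ℝ) := by
      have h1 : (τ : ℝ) / 2 ≤ ((min t τ : ℕ) : ℝ) := by
        have : τ ≤ 2 * min t τ := by omega
        have : (τ : ℝ) ≤ 2 * ((min t τ : ℕ) : ℝ) := by exact_mod_cast this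
        linarith
      have h4 : (4 : ℝ) ≤ τ := by exact_mod_cast hτ
      have h2 := Real.log_le_log (by linarith) h1
      rw [Real.log_div (by linarith) (by norm_num)] at h2
      have h3 := Real.log_le_log (by norm_num) h4
      rw [show (4 : ℝ) = 2 ^ 2 by norm_num, Real.log_pow] at h3
      push_cast at h3
      have : 0 ≤ Real.log τ := Real.log_nonneg (by linarith)
      linarith
    have hL2 : L / 2 = √(ξ * (1 / 4 * Real.log τ)) := by
      rw [show ξ * (1 / 4 * Real.log τ) = ξ * Real.log τ / 2 ^ 2 by ring,
        Real.sqrt_div' _ (by norm_num), Real.sqrt_sq (by norm_num)]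
    rw [hL2, confRadius, Real.sqrt_div' _ (Nat.cast_nonneg _)]
    have : 0 < √(windowCount τ arm t a : ℝ) := Real.sqrt_pos.2 (by exact_mod_cast hna1)
    gcongr
  have hkey : L / 2 / √m ≤ 1 + (4 * l + 1) * L / √n := by
    calc L / 2 / √m ≤ 1 + 4 * l * L / √n + L / √n := by linarith
      _ = _ := by ring
  -- The bound 1 on the true average absorbs only half of the scarce arm's radius; the other half
  -- bounds n in terms of m.
  have h1 : 1 ≤ L / (4 * √m) := by rw [le_div_iff₀ (by positivity)]; linarith
  have h2 : L / (4 * √m) ≤ (4 * l + 1) * L / √n := by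
    have : L / 2 / √m = L / (4 * √m) + L / (4 * √m) := by field_simp; norm_num
    linarith
  rw [div_le_div_iff₀ (by positivity) hsn] at h2
  have h3 : √(n : ℝ) ≤ 4 * (4 * l + 1) * √m := by
    have : L * √n ≤ L * (4 * (4 * l + 1) * √m) := by linarith
    exact le_of_mul_le_mul_left this hLpos
  calc (n : ℝ) = √n ^ 2 := (Real.sq_sqrt (by positivity)).symm
    _ ≤ (4 * (4 * l + 1) * √m) ^ 2 := by gcongr
    _ = _ := by rw [mul_pow, Real.sq_sqrt (by positivity)]

/-- Induction on the number of scarce arms. The arms of S have too few pulls to fill the last q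
rounds, so some round u among these pulls a new arm. At u the missing arm a has at most q pulls, so
`windowCount_pulled_le` makes the new arm scarce at u. Moving the window on to t adds at most q
pulls, which accounts for the summand 1 in the bound on G. -/
lemma IsTrajectory.exists_scarce (h : IsTrajectory ξ τ T f x arm greedy r)
    (hf : IsDrift l T f) (hx : ∀ t, 1 ≤ t → t ≤ T → ∀ b, x t b ∈ Set.Icc (0 : ℝ) 1)
    (hξ : 0 < ξ) {G m : ℕ} (hG : (4 * (4 * l + 1)) ^ 2 + 1 ≤ (G : ℝ))
    (hm : m = K * scarceCount G K K + 1) (hτ : 4 * m + K + 4 ≤ τ)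
    (hM : (1 + l : ℝ) ^ K ≤ √(ξ * Real.log τ)) (hmL : 4 * √m ≤ √(ξ * Real.log τ))
    {t : ℕ} (hT : t ≤ T) (hτt : τ < t)
    (hdrop : ∀ s, K < s → s < t → ∀ b, 1 ≤ windowCount τ arm s b)
    {a : Fin K} (ha : windowCount τ arm t a = 0) (k : ℕ) (hk : k ≤ K) :
    ∃ S : Finset (Fin K), k ≤ S.card ∧ ∀ b ∈ S, windowCount τ arm t b ≤ scarceCount G K k := by
  have hKpos : 1 ≤ K := (Nat.zero_le _).trans_lt a.2
  have hG1 : 1 ≤ G := by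
    have : (1 : ℝ) ≤ G := by nlinarith [sq_nonneg (4 * (4 * (l : ℝ) + 1))]
    exact_mod_cast this
  have hmono := monotone_nat_of_le_succ (scarceCount_le_succ (K := K) hG1 hKpos)
  induction k with
  | zero => exact ⟨∅, by simp⟩
  | succ k ih =>
    obtain ⟨S, hS, hScount⟩ := ih (by omega)
    set q := K * scarceCount G K k + 1 with hq
    have hqm : q ≤ m := by
      rw [hm, hq]; gcongr; exact hmono (by omega)
    have hex : ∃ u, t - q ≤ u ∧ u < t ∧ arm u ∉ S := by
      by_contra! hcon
      have hsub : Finset.Ico (t - q) t ⊆ S.biUnion (windowPulls τ arm t) := by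
        intro u hu
        rw [Finset.mem_Ico] at hu
        rw [Finset.mem_biUnion]
        exact ⟨arm u, hcon u hu.1 hu.2, mem_windowPulls.2 ⟨by omega, rfl⟩⟩
      have h1 := Finset.card_le_card hsub
      have h2 := Finset.card_biUnion_le_card_mul S (windowPulls τ arm t) _ hScount
      have h3 : S.card ≤ K := by simpa using Finset.card_le_univ S
      have h4 := Nat.mul_le_mul_right (scarceCount G K k) h3
      rw [Nat.card_Ico] at h1
      omega
    obtain ⟨u, hu1, hu2, huS⟩ := hex
    refine ⟨insert (arm u) S, by rw [Finset.card_insert_of_notMem huS]; omega, fun b hb => ?_⟩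
    rw [Finset.mem_insert] at hb
    rcases hb with rfl | hb
    · have hua : windowCount τ arm u a ≤ q := by
        have := windowCount_le_add (τ := τ) (arm := arm) (b := a) hu2.le
        omega
      have hqL : 4 * √(q : ℝ) ≤ √(ξ * Real.log τ) := by
        refine le_trans ?_ hmL
        have : (q : ℝ) ≤ m := by exact_mod_cast hqm
        gcongr
      have hcount := h.windowCount_pulled_le hf hx hξ (by omega) hM (t := u) (by omega) (by omega)
        (by omega) (fun s hs hsu b => hdrop s hs (by omega) b) hua hqL
      have hadd := windowCount_le_add' (τ := τ) (arm := arm) (b := arm u) hu2.le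
      have hadd' : (windowCount τ arm t (arm u) : ℝ) ≤ windowCount τ arm u (arm u) + q := by
        exact_mod_cast hadd.trans (by omega)
      have : (windowCount τ arm t (arm u) : ℝ) ≤ (G * q : ℕ) := by
        push_cast
        have := mul_le_mul_of_nonneg_right hG (Nat.cast_nonneg (α := ℝ) q)
        linarith
      exact_mod_cast this
    · exact (hScount b hb).trans (hmono (Nat.le_succ k))

/-- For long windows, every arm occurs in the window of every round after the first `K`. -/
lemma IsTrajectory.one_le_windowCount (h : IsTrajectory ξ τ T f x arm greedy r)
    (hf : IsDrift l T f) (hx : ∀ t, 1 ≤ t → t ≤ T → ∀ b, x t b ∈ Set.Icc (0 : ℝ) 1)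
    (hξ : 0 < ξ) {G m : ℕ} (hG : (4 * (4 * l + 1)) ^ 2 + 1 ≤ (G : ℝ))
    (hm : m = K * scarceCount G K K + 1) (hτ : 4 * m + K + 4 ≤ τ)
    (hM : (1 + l : ℝ) ^ K ≤ √(ξ * Real.log τ)) (hmL : 4 * √m ≤ √(ξ * Real.log τ))
    {t : ℕ} (hK : K < t) (hT : t ≤ T) (a : Fin K) : 1 ≤ windowCount τ arm t a := by
  induction t using Nat.strong_induction_on generalizing a with
  | _ t ih =>
    by_contra hcon
    have ha : windowCount τ arm t a = 0 := by omega
    -- Up to round τ, the forced initial pull of a is still inside the window.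
    have hτt : τ < t := by
      by_contra! hle
      have hinit := h.init (a + 1) (by omega) (by omega) (by omega)
      have harm : arm (a + 1) = a := Fin.ext (by omega)
      have : (a : ℕ) + 1 ∈ windowPulls τ arm t a := mem_windowPulls.2 ⟨by omega, harm⟩
      rw [windowCount, Finset.card_eq_zero] at ha
      simp [ha] at this
    obtain ⟨S, hS, hcount⟩ := h.exists_scarce hf hx hξ hG hm hτ hM hmL hT hτt
      (fun s hs hst b => ih s hst hs (by omega) b) ha K le_rfl
    have hSu : S = Finset.univ := by
      rw [← Finset.card_eq_iff_eq_univ, Fintype.card_fin]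
      exact le_antisymm (by simpa using Finset.card_le_univ S) hS
    subst hSu
    -- All K arms are scarce, yet together they have exactly τ pulls, more than K times the scarcity
    -- bound.
    have h1 := Finset.sum_le_card_nsmul _ _ _ hcount
    rw [sum_windowCount hτt, smul_eq_mul, Finset.card_univ, Fintype.card_fin] at h1
    omega

/-- In a round in which a suboptimal arm that occurs often in the window is pulled, the average
true reward of this arm or of a better arm deviates from its mean. -/
lemma IsTrajectory.deviation (h : IsTrajectory ξ τ T f x arm greedy r)
    (hf : IsDrift l T f) (hx : ∀ t, 1 ≤ t → t ≤ T → ∀ b, x t b ∈ Set.Icc (0 : ℝ) 1)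
    (hξ : 0 < ξ) (hτ : 1 ≤ τ) (hM : (1 + l : ℝ) ^ K ≤ √(ξ * Real.log τ))
    {t : ℕ} (hK : K < t) (hT : t ≤ T) (hτt : τ < t)
    (hdrop : ∀ s, K < s → s ≤ t → ∀ b, 1 ≤ windowCount τ arm s b)
    {Δ : ℝ} (b : Fin K) {μa μb : ℝ} (hgap : Δ ≤ μb - μa)
    (hlarge : (4 * l + 1) * √(ξ * Real.log τ) ≤ Δ / 2 * √(windowCount τ arm t (arm t))) :
    √(ξ * Real.log τ) * √(windowCount τ arm t b) ≤
        ∑ s ∈ windowPulls τ arm t b, (μb - x s b) ∨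
      Δ / 2 * windowCount τ arm t (arm t) ≤
        ∑ s ∈ windowPulls τ arm t (arm t), (x s (arm t) - μa) := by
  set L := √(ξ * Real.log τ) with hL
  set n := windowCount τ arm t (arm t) with hn
  set nb := windowCount τ arm t b with hnb
  have hn1 : 1 ≤ n := hdrop t hK le_rfl _
  have hnb1 : 1 ≤ nb := hdrop t hK le_rfl _
  have hsn : 0 < √(n : ℝ) := Real.sqrt_pos.2 (by exact_mod_cast hn1)
  have hsnb : 0 < √(nb : ℝ) := Real.sqrt_pos.2 (by exact_mod_cast hnb1)
  have hnpos : (0 : ℝ) < n := by exact_mod_cast hn1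
  have hnbpos : (0 : ℝ) < nb := by exact_mod_cast hnb1
  -- Without either deviation the indices contradict the selection: that of b exceeds μb, while that
  -- of the pulled arm is below μa + Δ/2 plus drift and radius, which `hlarge` bounds by another
  -- Δ/2.
  by_contra! hcon
  obtain ⟨hE1, hE2⟩ := hcon
  rw [Finset.sum_sub_distrib, Finset.sum_const, nsmul_eq_mul] at hE1 hE2
  change (nb : ℝ) * μb - _ < _ at hE1
  change _ - (n : ℝ) * μa < _ at hE2
  have hidx := (h.index_le hK hT hn1 b).2
  have hmean := h.windowMean_le_trueMean hf hx hξ hτ hM (by omega)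
    (fun s hs hst => hdrop s hs hst.le _) hn1
  have hmeanb := h.trueMean_le_windowMean hf (t := t) (by omega) b
  have hconf : confRadius ξ τ arm t (arm t) ≤ L / √n := confRadius_le hξ (by omega) hτ
  have hconfb : confRadius ξ τ arm t b = L / √nb := by
    rw [confRadius, Real.sqrt_div' _ (Nat.cast_nonneg _), min_eq_right hτt.le]
  have h1 : μb - L / √nb < trueMean τ arm x t b := by
    rw [trueMean, lt_div_iff₀ hnbpos]
    have : L / √nb * nb = L * √nb := by
      rw [div_mul_eq_mul_div, div_eq_iff hsnb.ne', mul_assoc, Real.mul_self_sqrt hnbpos.le]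
    rw [sub_mul, this]
    linarith
  have h2 : trueMean τ arm x t (arm t) < μa + Δ / 2 := by
    rw [trueMean, div_lt_iff₀ hnpos]
    linarith
  have h3 : (4 * l + 1) * L / √n ≤ Δ / 2 := by
    rw [div_le_iff₀ hsn]; exact hlarge
  have h4 : (4 * l + 1) * L / √n = 4 * l * L / √n + L / √n := by ring
  linarith

end Trajectory

/-! ### Exponential deviation bounds -/

lemma measurableSet_arm_eq {Ω : Type*} {m : MeasurableSpace Ω} {K : ℕ} {g : Ω → Fin K}
    (hg : Measurable[m] g) (b : Fin K) : MeasurableSet[m] {ω | g ω = b} :=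
  hg (measurableSet_singleton b)

section Probability

variable {Ω : Type*} [m : MeasurableSpace Ω] {K : ℕ} {P : Measure Ω}
  {ℱ : Filtration ℕ m} {T : ℕ} {X : ℕ → Ω → Fin K → ℝ} {arm : ℕ → Ω → Fin K}

lemma IsEnvironment.measurable (hX : IsEnvironment P ℱ T X) {t : ℕ} (h1 : 1 ≤ t) (hT : t ≤ T)
    (a : Fin K) : Measurable (fun ω => X t ω a) :=
  (measurable_pi_apply a).comp ((hX.adapted t h1 hT).mono (ℱ.le t) le_rfl)

lemma IsEnvironment.integrable [IsProbabilityMeasure P] (hX : IsEnvironment P ℱ T X) {t : ℕ} (h1 : 1 ≤ t) (hT : t ≤ T)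
    (a : Fin K) : Integrable (fun ω => X t ω a) P := by
  refine Integrable.of_bound (hX.measurable h1 hT a).aestronglyMeasurable 1 (ae_of_all _ fun ω => ?_)
  have := hX.mem_Icc t h1 hT ω a
  rw [Real.norm_eq_abs, abs_of_nonneg this.1]
  exact this.2

lemma IsEnvironment.meanReward_mem_Icc [IsProbabilityMeasure P] (hX : IsEnvironment P ℱ T X) {t : ℕ} (h1 : 1 ≤ t)
    (hT : t ≤ T) (a : Fin K) : meanReward P X t a ∈ Set.Icc (0 : ℝ) 1 := by
  constructor
  · exact integral_nonneg fun ω => (hX.mem_Icc t h1 hT ω a).1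
  · have := integral_mono (hX.integrable h1 hT a) (integrable_const (μ := P) (1 : ℝ))
      fun ω => (hX.mem_Icc t h1 hT ω a).2
    simpa [meanReward] using this

/-- Hoeffding's lemma for a single reward. -/
lemma IsEnvironment.lintegral_exp_le_one [IsProbabilityMeasure P] (hX : IsEnvironment P ℱ T X) {t : ℕ} (h1 : 1 ≤ t)
    (hT : t ≤ T) (a : Fin K) (c : ℝ) :
    ∫⁻ ω, ENNReal.ofReal (Real.exp (c * (X t ω a - meanReward P X t a) - c ^ 2 / 8)) ∂P ≤ 1 := by
  have hsub := hasSubgaussianMGF_of_mem_Icc (μ := P) (X := fun ω => X t ω a) (a := 0) (b := 1)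
    (hX.measurable h1 hT a).aemeasurable (ae_of_all _ fun ω => hX.mem_Icc t h1 hT ω a)
  have hint := hsub.integrable_exp_mul c
  have hmgf := hsub.mgf_le c
  have heq : ∀ ω, Real.exp (c * (X t ω a - meanReward P X t a) - c ^ 2 / 8) =
      Real.exp (c * (X t ω a - ∫ ω, X t ω a ∂P)) * Real.exp (-(c ^ 2 / 8)) := by
    intro ω; rw [← Real.exp_add]; rfl
  simp_rw [heq]
  rw [← ofReal_integral_eq_lintegral_ofReal (hint.mul_const _)
    (ae_of_all _ fun ω => by positivity), integral_mul_const]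
  rw [← ENNReal.ofReal_one]
  apply ENNReal.ofReal_le_ofReal
  rw [mgf] at hmgf
  have hexp : (((‖(1 : ℝ) - 0‖₊ / 2) ^ 2 : ℝ≥0) : ℝ) * c ^ 2 / 2 = c ^ 2 / 8 := by
    push_cast; norm_num; ring
  rw [hexp] at hmgf
  calc _ ≤ Real.exp (c ^ 2 / 8) * Real.exp (-(c ^ 2 / 8)) := by gcongr
    _ = 1 := by rw [← Real.exp_add]; simp

/-- One factor of the exponential supermartingale that tracks the rewards of arm `b`. -/
noncomputable def expFactor (P : Measure Ω) (X : ℕ → Ω → Fin K → ℝ) (arm : ℕ → Ω → Fin K) (c : ℝ)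
    (b : Fin K) (s : ℕ) (ω : Ω) : ENNReal :=
  if arm s ω = b then ENNReal.ofReal (Real.exp (c * (X s ω b - meanReward P X s b) - c ^ 2 / 8))
  else 1

lemma IsEnvironment.measurable_expFactor (hX : IsEnvironment P ℱ T X)
    (harm : ∀ t, 1 ≤ t → t ≤ T → Measurable[ℱ (t - 1)] (arm t)) (c : ℝ) (b : Fin K) {s : ℕ}
    (h1 : 1 ≤ s) (hT : s ≤ T) : Measurable[ℱ s] (expFactor P X arm c b s) := by
  have hXs : Measurable[ℱ s] fun ω => X s ω b :=
    (measurable_pi_apply b).comp (hX.adapted s h1 hT)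
  refine Measurable.ite ?_ ?_ measurable_const
  · exact measurableSet_arm_eq ((harm s h1 hT).mono (ℱ.mono (Nat.sub_le s 1)) le_rfl) b
  · exact (Real.measurable_exp.comp (((hXs.sub_const _).const_mul c).sub_const _)).ennreal_ofReal

lemma IsEnvironment.measurable_prod_expFactor (hX : IsEnvironment P ℱ T X)
    (harm : ∀ t, 1 ≤ t → t ≤ T → Measurable[ℱ (t - 1)] (arm t)) (c : ℝ) (b : Fin K) {u v : ℕ}
    (hu : 1 ≤ u) (hv : v ≤ T) :
    Measurable[ℱ v] fun ω => ∏ s ∈ Finset.Ico u (v + 1), expFactor P X arm c b s ω := by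
  refine Finset.measurable_fun_prod _ fun s hs => ?_
  rw [Finset.mem_Ico] at hs
  exact (hX.measurable_expFactor harm c b (by omega) (by omega)).mono (ℱ.mono (by omega)) le_rfl

/-- The supermartingale property: the choice of the last arm and all earlier factors are known
before the last round, whose reward is independent of them, so Hoeffding's lemma removes the last
factor. -/
lemma IsEnvironment.lintegral_prod_expFactor_le_one [IsProbabilityMeasure P] (hX : IsEnvironment P ℱ T X)
    (harm : ∀ t, 1 ≤ t → t ≤ T → Measurable[ℱ (t - 1)] (arm t)) (c : ℝ) (b : Fin K) {u v : ℕ}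
    (hu : 1 ≤ u) (hv : v ≤ T) :
    ∫⁻ ω, ∏ s ∈ Finset.Ico u (v + 1), expFactor P X arm c b s ω ∂P ≤ 1 := by
  induction v with
  | zero => rw [Finset.Ico_eq_empty (by omega)]; simp
  | succ v ih =>
    rcases le_or_gt u (v + 1) with huv | huv
    swap
    · rw [Finset.Ico_eq_empty (by omega)]; simp
    set W : Ω → ENNReal := fun ω => ∏ s ∈ Finset.Ico u (v + 1), expFactor P X arm c b s ω with hW
    set φ : Ω → ENNReal := fun ω => ENNReal.ofReal
      (Real.exp (c * (X (v + 1) ω b - meanReward P X (v + 1) b) - c ^ 2 / 8)) with hφ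
    set A : Set Ω := {ω | arm (v + 1) ω = b} with hA
    have hWm : Measurable[ℱ v] W := hX.measurable_prod_expFactor harm c b hu (by omega)
    have hAm : MeasurableSet[ℱ v] A := measurableSet_arm_eq (harm (v + 1) (by omega) hv) b
    have hφm : Measurable[MeasurableSpace.comap (X (v + 1)) inferInstance] φ := by
      have h0 : Measurable[MeasurableSpace.comap (X (v + 1)) inferInstance]
          fun ω => X (v + 1) ω b := (measurable_pi_apply b).comp (comap_measurable _)
      exact (Real.measurable_exp.comp
        (((h0.sub_const _).const_mul c).sub_const _)).ennreal_ofReal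
    have hle : MeasurableSpace.comap (X (v + 1)) inferInstance ≤ m :=
      ((hX.adapted (v + 1) (by omega) hv).mono (ℱ.le _) le_rfl).comap_le
    have hsplit : ∀ ω, ∏ s ∈ Finset.Ico u (v + 1 + 1), expFactor P X arm c b s ω =
        A.indicator W ω * φ ω + Aᶜ.indicator W ω := by
      intro ω
      rw [Finset.prod_Ico_succ_top huv, expFactor]
      by_cases hω : ω ∈ A
      · have hω' : arm (v + 1) ω = b := hω
        simp [hω, hω', hW, hφ]
      · have hω' : arm (v + 1) ω ≠ b := hω
        simp [hω, hω', hW]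
    have hWA : Measurable[ℱ v] (A.indicator W) := hWm.indicator hAm
    simp_rw [hsplit]
    rw [lintegral_add_right _ ((hWm.indicator hAm.compl).mono (ℱ.le v) le_rfl),
      lintegral_mul_eq_lintegral_mul_lintegral_of_independent_measurableSpace (ℱ.le v) hle
        (hX.indep (v + 1) (by omega) hv).symm hWA hφm]
    calc (∫⁻ ω, A.indicator W ω ∂P) * (∫⁻ ω, φ ω ∂P) + ∫⁻ ω, Aᶜ.indicator W ω ∂P
        ≤ (∫⁻ ω, A.indicator W ω ∂P) * 1 + ∫⁻ ω, Aᶜ.indicator W ω ∂P := by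
          gcongr
          exact hX.lintegral_exp_le_one (by omega) hv b c
      _ = ∫⁻ ω, (A.indicator W ω + Aᶜ.indicator W ω) ∂P := by
          rw [mul_one, lintegral_add_right _ ((hWm.indicator hAm.compl).mono (ℱ.le v) le_rfl)]
      _ = ∫⁻ ω, W ω ∂P := by simp_rw [Set.indicator_self_add_compl_apply]
      _ ≤ 1 := ih (by omega)

/-- The event that the exponential supermartingale of arm `b` with parameter `c` over the window
before round `t` reaches `τ`. -/
def deviationEvent (P : Measure Ω) (X : ℕ → Ω → Fin K → ℝ) (arm : ℕ → Ω → Fin K) (τ t : ℕ)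
    (b : Fin K) (c : ℝ) : Set Ω :=
  {ω | (τ : ENNReal) ≤ ∏ s ∈ Finset.Ico (max 1 (t - τ)) t, expFactor P X arm c b s ω}

lemma IsEnvironment.measurableSet_deviationEvent (hX : IsEnvironment P ℱ T X)
    (harm : ∀ t, 1 ≤ t → t ≤ T → Measurable[ℱ (t - 1)] (arm t)) (τ : ℕ) {t : ℕ} (h1 : 1 ≤ t)
    (hT : t ≤ T) (b : Fin K) (c : ℝ) : MeasurableSet (deviationEvent P X arm τ t b c) := by
  obtain ⟨t, rfl⟩ : ∃ k, t = k + 1 := ⟨t - 1, by omega⟩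
  exact measurableSet_le measurable_const
    ((hX.measurable_prod_expFactor harm c b (le_max_left _ _) (by omega)).mono (ℱ.le t) le_rfl)

/-- Markov's inequality for the supermartingale. -/
lemma IsEnvironment.measureReal_deviationEvent_le [IsProbabilityMeasure P] (hX : IsEnvironment P ℱ T X)
    (harm : ∀ t, 1 ≤ t → t ≤ T → Measurable[ℱ (t - 1)] (arm t)) {τ : ℕ} (hτ : 1 ≤ τ) {t : ℕ}
    (h1 : 1 ≤ t) (hT : t ≤ T) (b : Fin K) (c : ℝ) :
    P.real (deviationEvent P X arm τ t b c) ≤ 1 / τ := by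
  obtain ⟨t, rfl⟩ : ∃ k, t = k + 1 := ⟨t - 1, by omega⟩
  have h := (mul_meas_ge_le_lintegral
    ((hX.measurable_prod_expFactor harm c b (le_max_left 1 (t + 1 - τ)) (by omega)).mono
      (ℱ.le t) le_rfl) (τ : ENNReal)).trans
    (hX.lintegral_prod_expFactor_le_one harm c b (le_max_left 1 (t + 1 - τ)) (by omega))
  have h2 := ENNReal.toReal_mono ENNReal.one_ne_top h
  rw [ENNReal.toReal_mul, ENNReal.toReal_natCast, ENNReal.toReal_one] at h2
  rw [le_div_iff₀ (by exact_mod_cast hτ), mul_comm]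
  exact h2

lemma mem_deviationEvent {τ t : ℕ} (hτ : 1 ≤ τ) {b : Fin K} {c : ℝ} {ω : Ω}
    (h : Real.log τ ≤ c * ∑ s ∈ windowPulls τ (fun s => arm s ω) t b,
        (X s ω b - meanReward P X s b) -
      c ^ 2 / 8 * windowCount τ (fun s => arm s ω) t b) :
    ω ∈ deviationEvent P X arm τ t b c := by
  have hprod : ∏ s ∈ Finset.Ico (max 1 (t - τ)) t, expFactor P X arm c b s ω =
      ENNReal.ofReal (Real.exp (∑ s ∈ windowPulls τ (fun s => arm s ω) t b,
        (c * (X s ω b - meanReward P X s b) - c ^ 2 / 8))) := by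
    rw [Real.exp_sum, ENNReal.ofReal_prod_of_nonneg fun _ _ => (Real.exp_pos _).le, windowPulls,
      Finset.prod_filter]
    rfl
  change (τ : ENNReal) ≤ _
  rw [hprod, ← ENNReal.ofReal_natCast]
  apply ENNReal.ofReal_le_ofReal
  have hτ0 : (0 : ℝ) < τ := by exact_mod_cast hτ
  rw [← Real.log_le_iff_le_exp hτ0]
  rw [Finset.sum_sub_distrib, ← Finset.mul_sum, Finset.sum_const, nsmul_eq_mul]
  rw [windowCount] at h
  linarith

/-- Peeling: a self-normalized deviation of size `√(ξ log τ)` lies in one of logarithmically many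
deviation events. -/
lemma exists_mem_deviationEvent {ξ q : ℝ} (hξ : 0 < ξ) (hq : 1 < q)
    (hqξ : 2 * ξ * (1 - (q - 1) ^ 2) = 1) {τ t : ℕ} (hτ : 1 ≤ τ) {b : Fin K} {ω : Ω}
    (hn : 1 ≤ windowCount τ (fun s => arm s ω) t b)
    (h : √(ξ * Real.log τ) * √(windowCount τ (fun s => arm s ω) t b) ≤
      ∑ s ∈ windowPulls τ (fun s => arm s ω) t b, (meanReward P X s b - X s ω b)) :
    ∃ k ∈ Finset.range (⌊Real.log τ / Real.log q⌋₊ + 1),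
      ω ∈ deviationEvent P X arm τ t b (-(4 * √(ξ * Real.log τ) / q ^ k)) := by
  set n := windowCount τ (fun s => arm s ω) t b with hn'
  set L := √(ξ * Real.log τ) with hL
  have hL0 : 0 ≤ L := Real.sqrt_nonneg _
  have hτ1 : (1 : ℝ) ≤ τ := by exact_mod_cast hτ
  have hn1 : (1 : ℝ) ≤ n := by exact_mod_cast hn
  have hL2 : L ^ 2 = ξ * Real.log τ :=
    Real.sq_sqrt (mul_nonneg hξ.le (Real.log_nonneg hτ1))
  -- The optimal Chernoff parameter has size 4L/√n, but n is random; √n is replaced by the grid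
  -- point q ^ k just below it.
  obtain ⟨k, hk1, hk2⟩ := exists_nat_pow_near (Real.one_le_sqrt.2 hn1) hq
  have hqk : 0 < q ^ k := by positivity
  refine ⟨k, ?_, mem_deviationEvent hτ ?_⟩
  · rw [Finset.mem_range, Nat.lt_succ_iff, Nat.le_floor_iff
      (div_nonneg (Real.log_nonneg hτ1) (Real.log_pos hq).le), le_div_iff₀ (Real.log_pos hq),
      ← Real.log_pow]
    apply Real.log_le_log hqk
    calc q ^ k ≤ √n := hk1
      _ ≤ √n * √n := by nlinarith [Real.one_le_sqrt.2 hn1]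
      _ = n := Real.mul_self_sqrt (by positivity)
      _ ≤ τ := by exact_mod_cast windowCount_le
  -- With the rounding error v in [1, q), the exponent is at least 4L²v − 2L²v² = 2L²(1 − (v − 1)²),
  -- and `hqξ` says that its value at v = q is log τ.
  · obtain ⟨v, hv⟩ : ∃ v, √(n : ℝ) = q ^ k * v := ⟨√n / q ^ k, by field_simp⟩
    have hv1 : 1 ≤ v := by
      rw [hv] at hk1; exact le_of_mul_le_mul_left (by linarith) hqk
    have hv2 : v < q := by
      rw [hv, pow_succ] at hk2; exact lt_of_mul_lt_mul_left hk2 hqk.le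
    have hnv : (n : ℝ) = (q ^ k * v) ^ 2 := by rw [← hv, Real.sq_sqrt (by positivity)]
    have hneg : ∑ s ∈ windowPulls τ (fun s => arm s ω) t b, (X s ω b - meanReward P X s b) =
        -∑ s ∈ windowPulls τ (fun s => arm s ω) t b, (meanReward P X s b - X s ω b) := by
      rw [← Finset.sum_neg_distrib]; simp
    rw [hneg, neg_mul_neg, ← hn', hnv]
    rw [hv] at h
    have h1 : 4 * L / q ^ k * (L * (q ^ k * v)) ≤ 4 * L / q ^ k *
        ∑ s ∈ windowPulls τ (fun s => arm s ω) t b, (meanReward P X s b - X s ω b) := by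
      gcongr
    have h2 : 4 * L / q ^ k * (L * (q ^ k * v)) = 4 * L ^ 2 * v := by field_simp
    have h3 : (-(4 * L / q ^ k)) ^ 2 / 8 * (q ^ k * v) ^ 2 = 2 * L ^ 2 * v ^ 2 := by
      field_simp; ring
    have h4 : Real.log τ = 2 * L ^ 2 * (1 - (q - 1) ^ 2) := by
      rw [hL2]; linear_combination (-Real.log τ) * hqξ
    have h5 : 2 * L ^ 2 * (1 - (q - 1) ^ 2) ≤ 2 * L ^ 2 * (1 - (v - 1) ^ 2) := by
      gcongr
    rw [h3, h4]
    linarith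

end Probability

/-! ### Counting rounds -/

/-- Rounds in which arm `a` is pulled although it has few pulls in the window are rare. -/
lemma card_pulls_of_windowCount_lt {K : ℕ} (arm : ℕ → Fin K) {τ : ℕ} (hτ : 1 ≤ τ) (T A : ℕ)
    (a : Fin K) :
    ((Finset.Icc 1 T).filter (fun t => arm t = a ∧ windowCount τ arm t a < A)).card ≤
      A * (T / τ + 1) := by
  set S := (Finset.Icc 1 T).filter (fun t => arm t = a ∧ windowCount τ arm t a < A) with hS
  have hfib : ∀ j ∈ S.image (· / τ), (S.filter (fun t => t / τ = j)).card ≤ A := by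
    intro j hj
    set F := S.filter (fun t => t / τ = j) with hF
    have hne : F.Nonempty := by
      obtain ⟨t, ht, rfl⟩ := Finset.mem_image.1 hj
      exact ⟨t, Finset.mem_filter.2 ⟨ht, rfl⟩⟩
    have hmem : ∀ s ∈ F, (1 ≤ s ∧ s ≤ T) ∧ (arm s = a ∧ windowCount τ arm s a < A) ∧ s / τ = j := by
      intro s hs
      rw [hF, hS, Finset.mem_filter, Finset.mem_filter, Finset.mem_Icc] at hs
      exact ⟨hs.1.1, hs.1.2, hs.2⟩
    -- Cut time into blocks of length τ. The window of the last such pull in a block contains all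
    -- the earlier ones, so they number less than A.
    set u := F.max' hne with hu
    have huF : u ∈ F := F.max'_mem hne
    have hsub : F.erase u ⊆ windowPulls τ arm u a := by
      intro s hs
      have hsF := Finset.mem_of_mem_erase hs
      have hlt : s < u := F.lt_max'_of_mem_erase_max' hne hs
      rw [mem_windowPulls]
      refine ⟨⟨(hmem s hsF).1.1, ?_, hlt⟩, (hmem s hsF).2.1.1⟩
      have h1 := (hmem s hsF).2.2
      have h2 := (hmem u huF).2.2
      have h3 := Nat.div_mul_le_self s τ
      have h4 := Nat.lt_div_mul_add (a := u) (b := τ) (by omega)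
      rw [h1] at h3
      rw [h2] at h4
      omega
    have h1 := Finset.card_le_card hsub
    rw [Finset.card_erase_of_mem huF] at h1
    have h2 : (windowPulls τ arm u a).card < A := (hmem u huF).2.1.2
    omega
  refine (Finset.card_le_mul_card_image S A hfib).trans (Nat.mul_le_mul_left A ?_)
  have himg : S.image (· / τ) ⊆ Finset.range (T / τ + 1) := by
    intro j hj
    obtain ⟨t, ht, rfl⟩ := Finset.mem_image.1 hj
    rw [hS, Finset.mem_filter, Finset.mem_Icc] at ht
    rw [Finset.mem_range, Nat.lt_succ_iff]
    exact Nat.div_le_div_right ht.1.2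
  simpa using Finset.card_le_card himg

section Probability

variable {Ω : Type*} [m : MeasurableSpace Ω] {K : ℕ} {P : Measure Ω}
  {ℱ : Filtration ℕ m} {T : ℕ} {X : ℕ → Ω → Fin K → ℝ} {arm : ℕ → Ω → Fin K}

open Classical in
/-- The breakpoints, i.e. the rounds after which the reward distribution of some arm changes. -/
noncomputable def breakpoints (P : Measure Ω) (X : ℕ → Ω → Fin K → ℝ) (T : ℕ) : Finset ℕ :=
  (Finset.Ico 1 T).filter (fun t =>
    ∃ a : Fin K, P.map (fun ω => X t ω a) ≠ P.map (fun ω => X (t + 1) ω a))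

lemma IsEnvironment.meanReward_succ_eq (hX : IsEnvironment P ℱ T X) {t : ℕ} (h1 : 1 ≤ t)
    (hT : t < T) (ht : t ∉ breakpoints P X T) (a : Fin K) :
    meanReward P X (t + 1) a = meanReward P X t a := by
  have hmap : P.map (fun ω => X t ω a) = P.map (fun ω => X (t + 1) ω a) := by
    by_contra hne
    apply ht
    simp only [breakpoints, Finset.mem_filter]
    exact ⟨Finset.mem_Ico.2 ⟨h1, hT⟩, a, hne⟩
  have hmean : ∀ s, 1 ≤ s → s ≤ T →
      meanReward P X s a = ∫ y, y ∂(P.map fun ω => X s ω a) := fun s hs hsT =>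
    (integral_map (hX.measurable hs hsT a).aemeasurable
      aestronglyMeasurable_id).symm
  rw [hmean t h1 hT.le, hmean (t + 1) (by omega) hT, hmap]

/-- Without a breakpoint in the window, the means are constant there. -/
lemma IsEnvironment.meanReward_eq_of_window (hX : IsEnvironment P ℱ T X) {τ t : ℕ}
    (hT : t ≤ T) (ht : t ∉ (breakpoints P X T).biUnion fun s => Finset.Ioc s (s + τ)) {s : ℕ}
    (hs1 : 1 ≤ s) (hsτ : t ≤ s + τ) (hst : s ≤ t) (a : Fin K) :
    meanReward P X s a = meanReward P X t a := by
  simp only [Finset.mem_biUnion, Finset.mem_Ioc, not_exists, not_and] at ht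
  induction hst using Nat.decreasingInduction with
  | self => rfl
  | of_succ s hst ih =>
    rw [← ih (by omega) (by omega), hX.meanReward_succ_eq hs1 (by omega)]
    intro hbp
    exact absurd hsτ (by have := ht s hbp (by omega); omega)

/-- The bad event of round `t`: the average true reward of arm `a` is far too large, or that of arm `b`
is too small, measured by a grid of parameters with ratio `q`. -/
def badEvent (P : Measure Ω) (X : ℕ → Ω → Fin K → ℝ) (arm : ℕ → Ω → Fin K) (ξ q Δ : ℝ) (τ t : ℕ)
    (a b : Fin K) : Set Ω :=
  deviationEvent P X arm τ t a (2 * Δ) ∪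
    ⋃ k ∈ Finset.range (⌊Real.log τ / Real.log q⌋₊ + 1),
      deviationEvent P X arm τ t b (-(4 * √(ξ * Real.log τ) / q ^ k))

lemma IsEnvironment.measurableSet_badEvent (hX : IsEnvironment P ℱ T X)
    (harm : ∀ t, 1 ≤ t → t ≤ T → Measurable[ℱ (t - 1)] (arm t)) (ξ q Δ : ℝ) (τ : ℕ) {t : ℕ}
    (h1 : 1 ≤ t) (hT : t ≤ T) (a b : Fin K) :
    MeasurableSet (badEvent P X arm ξ q Δ τ t a b) :=
  (hX.measurableSet_deviationEvent harm τ h1 hT a _).union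
    (Finset.measurableSet_biUnion _ fun _ _ => hX.measurableSet_deviationEvent harm τ h1 hT b _)

lemma IsEnvironment.measureReal_badEvent_le [IsProbabilityMeasure P] (hX : IsEnvironment P ℱ T X)
    (harm : ∀ t, 1 ≤ t → t ≤ T → Measurable[ℱ (t - 1)] (arm t)) (ξ q Δ : ℝ) {τ : ℕ}
    (hτ : 1 ≤ τ) {t : ℕ} (h1 : 1 ≤ t) (hT : t ≤ T) (a b : Fin K) :
    P.real (badEvent P X arm ξ q Δ τ t a b) ≤
      ((⌊Real.log τ / Real.log q⌋₊ : ℝ) + 2) / τ := by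
  refine (measureReal_union_le _ _).trans ?_
  have h2 := measureReal_biUnion_finset_le (μ := P)
    (Finset.range (⌊Real.log τ / Real.log q⌋₊ + 1))
    (fun k => deviationEvent P X arm τ t b (-(4 * √(ξ * Real.log τ) / q ^ k)))
  have h3 := Finset.sum_le_card_nsmul (Finset.range (⌊Real.log τ / Real.log q⌋₊ + 1))
    (fun k => P.real (deviationEvent P X arm τ t b (-(4 * √(ξ * Real.log τ) / q ^ k)))) (1 / τ)
    fun k _ => hX.measureReal_deviationEvent_le harm hτ h1 hT b _
  rw [Finset.card_range, nsmul_eq_mul] at h3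
  push_cast at h3
  have h4 := hX.measureReal_deviationEvent_le harm hτ h1 hT a (2 * Δ)
  calc _ ≤ 1 / (τ : ℝ) + ((⌊Real.log τ / Real.log q⌋₊ : ℝ) + 1) * (1 / τ) := by linarith
    _ = _ := by ring

variable {ξ : ℝ} {τ : ℕ} {f : ℕ → ℝ → ℝ} {greedy : ℕ → Ω → Fin K} {r : ℕ → Ω → ℝ} {l : ℝ≥0}

lemma exists_bestMean_eq [Nonempty (Fin K)] (t : ℕ) : ∃ b, meanReward P X t b = bestMean P X t :=
  exists_eq_ciSup_of_finite

/-- A pull of a suboptimal arm that has many pulls in a window without breakpoints is due to a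
bad event. -/
lemma IsEnvironment.mem_badEvent (hX : IsEnvironment P ℱ T X) {ω : Ω}
    (h : IsTrajectory ξ τ T f (fun t => X t ω) (fun t => arm t ω) (fun t => greedy t ω)
      (fun t => r t ω))
    (hf : IsDrift l T f) (hξ : 0 < ξ) {q : ℝ} (hq : 1 < q)
    (hqξ : 2 * ξ * (1 - (q - 1) ^ 2) = 1) (hKτ : K ≤ τ) (hτ : 1 ≤ τ)
    (hM : (1 + l : ℝ) ^ K ≤ √(ξ * Real.log τ))
    (hdrop : ∀ s, K < s → s ≤ T → ∀ b, 1 ≤ windowCount τ (fun s => arm s ω) s b)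
    {Δ : ℝ} (hΔ : 0 < Δ) {A : ℕ} (hA : (4 * (4 * l + 1) ^ 2 * ξ + 2) / Δ ^ 2 * Real.log τ ≤ A)
    {t : ℕ} (hT : t ≤ T) (hτt : τ < t)
    (ht : t ∉ (breakpoints P X T).biUnion fun s => Finset.Ioc s (s + τ))
    {a b : Fin K} (ha : arm t ω = a) (hcount : A ≤ windowCount τ (fun s => arm s ω) t a)
    (hgap : Δ ≤ meanReward P X t b - meanReward P X t a) :
    ω ∈ badEvent P X arm ξ q Δ τ t a b := by
  subst ha
  set n := windowCount τ (fun s => arm s ω) t (arm t ω) with hn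
  have hlog : 0 ≤ Real.log τ := Real.log_nonneg (by exact_mod_cast hτ)
  have hl : (0 : ℝ) ≤ l := l.2
  have hAn : (4 * (4 * l + 1) ^ 2 * ξ + 2) * Real.log τ ≤ n * Δ ^ 2 := by
    -- The two summands in the threshold serve the two cases: the one with ξ makes drift plus radius
    -- at most Δ/2, the 2 makes the deviation of the pulled arm unlikely.
    have h1 : (A : ℝ) ≤ n := by exact_mod_cast hcount
    have h2 := hA.trans h1
    rwa [div_mul_eq_mul_div, div_le_iff₀ (by positivity)] at h2
  have hlarge : (4 * l + 1) * √(ξ * Real.log τ) ≤ Δ / 2 * √n := by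
    apply (pow_le_pow_iff_left₀ (by positivity) (by positivity) two_ne_zero).1
    rw [mul_pow, mul_pow, Real.sq_sqrt (by positivity), Real.sq_sqrt (by positivity)]
    nlinarith
  have hwin : ∀ c, ∀ s ∈ windowPulls τ (fun s => arm s ω) t c, ∀ d,
      meanReward P X s d = meanReward P X t d := by
    intro c s hs d
    rw [mem_windowPulls] at hs
    exact hX.meanReward_eq_of_window hT ht hs.1.1 hs.1.2.1 hs.1.2.2.le d
  rcases h.deviation hf (fun t h1 hT b => hX.mem_Icc t h1 hT ω b) hξ hτ hM (by omega) hT hτt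
    (fun s hs hst b => hdrop s hs (by omega) b) b hgap hlarge with hdev | hdev
  · right
    have hsum : ∑ s ∈ windowPulls τ (fun s => arm s ω) t b, (meanReward P X t b - X s ω b) =
        ∑ s ∈ windowPulls τ (fun s => arm s ω) t b, (meanReward P X s b - X s ω b) :=
      Finset.sum_congr rfl fun s hs => by rw [hwin b s hs]
    rw [hsum] at hdev
    obtain ⟨k, hk, hmem⟩ := exists_mem_deviationEvent hξ hq hqξ hτ
      (hdrop t (by omega) hT b) hdev
    exact Set.mem_biUnion hk hmem
  · left
    have hsum : ∑ s ∈ windowPulls τ (fun s => arm s ω) t (arm t ω),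
          (X s ω (arm t ω) - meanReward P X t (arm t ω)) =
        ∑ s ∈ windowPulls τ (fun s => arm s ω) t (arm t ω),
          (X s ω (arm t ω) - meanReward P X s (arm t ω)) :=
      Finset.sum_congr rfl fun s hs => by rw [hwin _ s hs]
    rw [hsum] at hdev
    apply mem_deviationEvent hτ
    -- The parameter 2Δ is optimal for a mean deviation of Δ/2 and leaves the exponent nΔ²/2.
    have h1 := mul_le_mul_of_nonneg_left hdev (by positivity : 0 ≤ 2 * Δ)
    have h2 : 2 * Real.log τ ≤ n * Δ ^ 2 := by
      have : 0 ≤ 4 * (4 * (l : ℝ) + 1) ^ 2 * ξ * Real.log τ := by positivity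
      linarith
    refine le_trans ?_ (sub_le_sub_right h1 _)
    change _ ≤ 2 * Δ * (Δ / 2 * n) - (2 * Δ) ^ 2 / 8 * n
    linarith

/-- The expected number of suboptimal pulls for a window that is long enough for no arm to leave
it. -/
lemma IsEnvironment.integral_suboptimalPulls_le [IsProbabilityMeasure P]
    (hX : IsEnvironment P ℱ T X)
    (harm : ∀ t, 1 ≤ t → t ≤ T → Measurable[ℱ (t - 1)] (arm t))
    (h : ∀ ω, IsTrajectory ξ τ T f (fun t => X t ω) (fun t => arm t ω) (fun t => greedy t ω)
      (fun t => r t ω))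
    (hf : IsDrift l T f) (hξ : 0 < ξ) {q : ℝ} (hq : 1 < q)
    (hqξ : 2 * ξ * (1 - (q - 1) ^ 2) = 1) (hKτ : K ≤ τ) (hτ : 1 ≤ τ)
    (hM : (1 + l : ℝ) ^ K ≤ √(ξ * Real.log τ))
    (hdrop : ∀ ω s, K < s → s ≤ T → ∀ b, 1 ≤ windowCount τ (fun s => arm s ω) s b)
    {Δ : ℝ} (hΔ : 0 < Δ) {A : ℕ} (hA : (4 * (4 * l + 1) ^ 2 * ξ + 2) / Δ ^ 2 * Real.log τ ≤ A)
    {a : Fin K} (hgap : HasGap P X T Δ a) :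
    ∫ ω, (suboptimalPulls P X T arm a ω : ℝ) ∂P ≤
      τ + numBreakpoints P X T * τ + A * (T / τ + 1) +
        T * (((⌊Real.log τ / Real.log q⌋₊ : ℝ) + 2) / τ) := by
  classical
  have : Nonempty (Fin K) := ⟨a⟩
  -- The comparison arm of a round is deterministic, so each round needs just one bad event.
  choose b hb using fun t => exists_bestMean_eq (P := P) (X := X) t
  set B : ℕ → Set Ω := fun t => badEvent P X arm ξ q Δ τ t a (b t) with hB
  set c : ℕ := τ + numBreakpoints P X T * τ + A * (T / τ + 1) with hc
  have hcount : ∀ ω, suboptimalPulls P X T arm a ω ≤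
      c + ((Finset.Ioc τ T).filter (fun t => ω ∈ B t)).card := by
    intro ω
    -- A suboptimal pull is early, or less than a window away from a breakpoint, or made with few
    -- pulls in the window, or due to a bad event.
    have hsub : (Finset.Icc 1 T).filter
          (fun t => arm t ω = a ∧ meanReward P X t a < bestMean P X t) ⊆
        ((Finset.Icc 1 τ ∪ (breakpoints P X T).biUnion fun s => Finset.Ioc s (s + τ)) ∪
          (Finset.Icc 1 T).filter
            (fun t => arm t ω = a ∧ windowCount τ (fun s => arm s ω) t a < A)) ∪
        (Finset.Ioc τ T).filter (fun t => ω ∈ B t) := by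
      intro t ht
      rw [Finset.mem_filter, Finset.mem_Icc] at ht
      obtain ⟨⟨h1, hT⟩, hta, hsubopt⟩ := ht
      simp only [Finset.mem_union]
      by_cases hτt : t ≤ τ
      · exact Or.inl (Or.inl (Or.inl (Finset.mem_Icc.2 ⟨h1, hτt⟩)))
      by_cases hbp : t ∈ (breakpoints P X T).biUnion fun s => Finset.Ioc s (s + τ)
      · exact Or.inl (Or.inl (Or.inr hbp))
      by_cases hAc : windowCount τ (fun s => arm s ω) t a < A
      · exact Or.inl (Or.inr (Finset.mem_filter.2 ⟨Finset.mem_Icc.2 ⟨h1, hT⟩, hta, hAc⟩))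
      · right
        rw [Finset.mem_filter, Finset.mem_Ioc]
        refine ⟨⟨by omega, hT⟩, ?_⟩
        refine hX.mem_badEvent (h ω) hf hξ hq hqξ hKτ hτ hM (hdrop ω) hΔ hA hT (by omega) hbp hta
          (by omega) ?_
        rw [hb t]
        exact hgap t h1 hT hsubopt
    have h1 := (Finset.card_le_card hsub).trans (Finset.card_union_le _ _)
    have h2 := Finset.card_union_le
      (Finset.Icc 1 τ ∪ (breakpoints P X T).biUnion fun s => Finset.Ioc s (s + τ))
      ((Finset.Icc 1 T).filter
        (fun t => arm t ω = a ∧ windowCount τ (fun s => arm s ω) t a < A))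
    have h3 := Finset.card_union_le (Finset.Icc 1 τ)
      ((breakpoints P X T).biUnion fun s => Finset.Ioc s (s + τ))
    have h4 := Finset.card_biUnion_le_card_mul (breakpoints P X T)
      (fun s => Finset.Ioc s (s + τ)) τ (fun s _ => by simp)
    have h5 := card_pulls_of_windowCount_lt (fun s => arm s ω) hτ T A a
    have h6 : (breakpoints P X T).card = numBreakpoints P X T := rfl
    have h7 : suboptimalPulls P X T arm a ω = ((Finset.Icc 1 T).filter
          (fun t => arm t ω = a ∧ meanReward P X t a < bestMean P X t)).card := by
      rw [suboptimalPulls]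
    rw [Nat.card_Icc] at h3
    rw [h6] at h4
    rw [h7]
    omega
  have hBm : ∀ t ∈ Finset.Ioc τ T, MeasurableSet (B t) := fun t ht => by
    rw [Finset.mem_Ioc] at ht
    exact hX.measurableSet_badEvent harm ξ q Δ τ (by omega) ht.2 a (b t)
  have hint : ∀ t ∈ Finset.Ioc τ T, Integrable ((B t).indicator fun _ => (1 : ℝ)) P :=
    fun t ht => (integrable_const 1).indicator (hBm t ht)
  calc ∫ ω, (suboptimalPulls P X T arm a ω : ℝ) ∂P
      ≤ ∫ ω, ((c : ℝ) + ∑ t ∈ Finset.Ioc τ T, (B t).indicator (fun _ => (1 : ℝ)) ω) ∂P := by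
        refine integral_mono_of_nonneg (ae_of_all _ fun ω => Nat.cast_nonneg _)
          ((integrable_const _).add (integrable_finsetSum _ hint)) (ae_of_all _ fun ω => ?_)
        have h1 : (suboptimalPulls P X T arm a ω : ℝ) ≤
            c + ((Finset.Ioc τ T).filter (fun t => ω ∈ B t)).card := by exact_mod_cast hcount ω
        refine h1.trans (le_of_eq ?_)
        rw [Finset.card_filter]
        push_cast
        simp only [Set.indicator_apply]
    _ = c + ∑ t ∈ Finset.Ioc τ T, P.real (B t) := by
        rw [integral_add (integrable_const _) (integrable_finsetSum _ hint),
          integral_finsetSum _ hint]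
        congr 1
        · simp
        · exact Finset.sum_congr rfl fun t ht => integral_indicator_one (hBm t ht)
    _ ≤ c + T * (((⌊Real.log τ / Real.log q⌋₊ : ℝ) + 2) / τ) := by
        have h1 := Finset.sum_le_card_nsmul (Finset.Ioc τ T) (fun t => P.real (B t)) _
          fun t ht => by
            rw [Finset.mem_Ioc] at ht
            exact hX.measureReal_badEvent_le harm ξ q Δ hτ (by omega) ht.2 a (b t)
        rw [nsmul_eq_mul, Nat.card_Ioc] at h1
        have h2 : ((T - τ : ℕ) : ℝ) ≤ T := by exact_mod_cast Nat.sub_le T τ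
        have h3 : 0 ≤ ((⌊Real.log τ / Real.log q⌋₊ : ℝ) + 2) / τ := by positivity
        have := mul_le_mul_of_nonneg_right h2 h3
        linarith
    _ ≤ _ := by
        have h1 : ((T / τ : ℕ) : ℝ) ≤ T / τ := Nat.cast_div_le
        rw [hc]
        push_cast
        gcongr

/-! ### Regret -/

/-- Decompose over the arms: the indicator of each choice depends on the past only, hence is
independent of the current reward. -/
lemma IsEnvironment.integral_pulled_reward [IsProbabilityMeasure P] (hX : IsEnvironment P ℱ T X)
    (harm : ∀ t, 1 ≤ t → t ≤ T → Measurable[ℱ (t - 1)] (arm t)) {t : ℕ} (h1 : 1 ≤ t)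
    (hT : t ≤ T) :
    Integrable (fun ω => X t ω (arm t ω)) P ∧ Integrable (fun ω => meanReward P X t (arm t ω)) P ∧
    ∫ ω, X t ω (arm t ω) ∂P = ∫ ω, meanReward P X t (arm t ω) ∂P := by
  set I : Fin K → Ω → ℝ := fun a => Set.indicator {ω | arm t ω = a} fun _ => 1 with hI
  have hA : ∀ a, MeasurableSet[ℱ (t - 1)] {ω | arm t ω = a} :=
    fun a => measurableSet_arm_eq (harm t h1 hT) a
  have hIm' : ∀ a, Measurable[ℱ (t - 1)] (I a) := fun a => measurable_const.indicator (hA a)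
  have hIm : ∀ a, Measurable (I a) := fun a => (hIm' a).mono (ℱ.le _) le_rfl
  have hIi : ∀ a, Integrable (I a) P := fun a => (integrable_const 1).indicator (ℱ.le _ _ (hA a))
  have hsum : ∀ (g : Fin K → ℝ) ω, g (arm t ω) = ∑ a, I a ω * g a := by
    intro g ω
    simp [hI, Set.indicator_apply]
  have hind : ∀ a, IndepFun (I a) (fun ω => X t ω a) P := by
    intro a
    rw [IndepFun_iff_Indep]
    refine indep_of_indep_of_le_left (indep_of_indep_of_le_right (hX.indep t h1 hT).symm ?_) ?_
    · exact ((measurable_pi_apply a).comp (comap_measurable (X t))).comap_le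
    · exact (hIm' a).comap_le
  have hprod : ∀ a ∈ Finset.univ, Integrable (fun ω => I a ω * X t ω a) P := fun a _ =>
    (hind a).integrable_mul (hIi a) (hX.integrable h1 hT a)
  have hprod2 : ∀ a ∈ Finset.univ, Integrable (fun ω => I a ω * meanReward P X t a) P :=
    fun a _ => (hIi a).mul_const _
  refine ⟨?_, ?_, ?_⟩
  · simp_rw [fun ω => hsum (X t ω) ω]
    exact integrable_finsetSum _ hprod
  · simp_rw [fun ω => hsum (meanReward P X t) ω]
    exact integrable_finsetSum _ hprod2
  · simp_rw [fun ω => hsum (X t ω) ω, fun ω => hsum (meanReward P X t) ω]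
    rw [integral_finsetSum _ hprod, integral_finsetSum _ hprod2]
    refine Finset.sum_congr rfl fun a _ => ?_
    rw [(hind a).integral_fun_mul_eq_mul_integral (hIm a).aestronglyMeasurable
      (hX.measurable h1 hT a).aestronglyMeasurable, integral_mul_const]
    rfl

lemma IsEnvironment.integrable_suboptimalPulls [IsProbabilityMeasure P]
    (harm : ∀ t, 1 ≤ t → t ≤ T → Measurable[ℱ (t - 1)] (arm t)) (a : Fin K) :
    Integrable (fun ω => (suboptimalPulls P X T arm a ω : ℝ)) P := by
  classical
  have hmeas : Measurable fun ω => (suboptimalPulls P X T arm a ω : ℝ) := by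
    simp only [suboptimalPulls, Finset.card_filter]
    push_cast
    refine Finset.measurable_fun_sum _ fun t ht => ?_
    rw [Finset.mem_Icc] at ht
    refine Measurable.ite ?_ measurable_const measurable_const
    exact (measurableSet_arm_eq ((harm t ht.1 ht.2).mono (ℱ.le _) le_rfl) a).inter
      (MeasurableSet.const _)
  refine Integrable.of_bound hmeas.aestronglyMeasurable T (ae_of_all _ fun ω => ?_)
  rw [Real.norm_natCast]
  have : suboptimalPulls P X T arm a ω ≤ T := by
    refine (Finset.card_filter_le _ _).trans ?_
    simp
  exact_mod_cast this

/-- The expected regret is at most the expected number of suboptimal pulls. -/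
lemma IsEnvironment.integral_regret_le [IsProbabilityMeasure P] (hX : IsEnvironment P ℱ T X)
    (harm : ∀ t, 1 ≤ t → t ≤ T → Measurable[ℱ (t - 1)] (arm t)) :
    ∫ ω, regret P X T arm ω ∂P ≤ ∑ a, ∫ ω, (suboptimalPulls P X T arm a ω : ℝ) ∂P := by
  classical
  have hr : ∀ t ∈ Finset.Icc 1 T, Integrable (fun ω => bestMean P X t - X t ω (arm t ω)) P :=
    fun t ht => by
      rw [Finset.mem_Icc] at ht
      exact (integrable_const _).sub (hX.integral_pulled_reward harm ht.1 ht.2).1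
  have hr2 : ∀ t ∈ Finset.Icc 1 T,
      Integrable (fun ω => bestMean P X t - meanReward P X t (arm t ω)) P :=
    fun t ht => by
      rw [Finset.mem_Icc] at ht
      exact (integrable_const _).sub (hX.integral_pulled_reward harm ht.1 ht.2).2.1
  calc ∫ ω, regret P X T arm ω ∂P
      = ∫ ω, ∑ t ∈ Finset.Icc 1 T, (bestMean P X t - meanReward P X t (arm t ω)) ∂P := by
        simp only [regret]
        rw [integral_finsetSum _ hr, integral_finsetSum _ hr2]
        refine Finset.sum_congr rfl fun t ht => ?_
        rw [Finset.mem_Icc] at ht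
        have h3 := hX.integral_pulled_reward harm ht.1 ht.2
        rw [integral_sub (integrable_const _) h3.1, integral_sub (integrable_const _) h3.2.1,
          h3.2.2]
    _ ≤ ∫ ω, ∑ a, (suboptimalPulls P X T arm a ω : ℝ) ∂P := by
        refine integral_mono (integrable_finsetSum _ hr2) (integrable_finsetSum _
          fun a _ => IsEnvironment.integrable_suboptimalPulls harm a) fun ω => ?_
        simp only [suboptimalPulls, Finset.card_filter]
        push_cast
        rw [Finset.sum_comm]
        refine Finset.sum_le_sum fun t ht => ?_
        rw [Finset.mem_Icc] at ht
        have hterm : bestMean P X t - meanReward P X t (arm t ω) ≤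
            if arm t ω = arm t ω ∧ meanReward P X t (arm t ω) < bestMean P X t then 1 else 0 := by
          split_ifs with hlt
          · have : Nonempty (Fin K) := ⟨arm t ω⟩
            obtain ⟨b, hb⟩ := exists_bestMean_eq (P := P) (X := X) t
            have h1 := (hX.meanReward_mem_Icc ht.1 ht.2 b).2
            have h2 := (hX.meanReward_mem_Icc ht.1 ht.2 (arm t ω)).1
            rw [hb] at h1
            linarith
          · have : ¬ meanReward P X t (arm t ω) < bestMean P X t := fun h => hlt ⟨rfl, h⟩
            linarith
        refine hterm.trans ?_
        exact Finset.single_le_sum (f := fun a =>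
            if arm t ω = a ∧ meanReward P X t a < bestMean P X t then (1 : ℝ) else 0)
          (fun a _ => by positivity) (Finset.mem_univ (arm t ω))
    _ = _ := integral_finsetSum _ fun a _ => IsEnvironment.integrable_suboptimalPulls harm a

end Probability

/-! ### Window lengths of order `√(T log T / β)` -/

/-- The quantities that appear in the bound, for `S = √(T log T / β)` and `Q = √(β T log T)`. -/
lemma window_estimates {c₁ c₂ : ℝ} (hc₁ : 0 < c₁) {T τ β : ℕ} (hT : 2 ≤ T)
    (hβ : 1 ≤ β) (hτ₁ : c₁ * √(T * Real.log T / β) ≤ τ) (hτ₂ : τ ≤ c₂ * √(T * Real.log T / β)) :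
    β * τ ≤ c₂ * √(β * T * Real.log T) ∧
    c₁ * (T * Real.log T) ≤ √(β * T * Real.log T) * τ ∧
    Real.log τ ≤ (Real.log (max c₂ 1) / Real.log 2 + 1) * Real.log T := by
  have hT2 : (2 : ℝ) ≤ T := by exact_mod_cast hT
  have hβ1 : (1 : ℝ) ≤ β := by exact_mod_cast hβ
  have hlog2 : 0 < Real.log 2 := Real.log_pos (by norm_num)
  have hlogT : Real.log 2 ≤ Real.log T := Real.log_le_log (by norm_num) hT2
  have hlogT0 : 0 < Real.log T := hlog2.trans_le hlogT
  set S := √(T * Real.log T / β) with hS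
  have hS0 : 0 < S := Real.sqrt_pos.2 (by positivity)
  have hS2 : S ^ 2 = T * Real.log T / β := Real.sq_sqrt (by positivity)
  have hQ : √(β * T * Real.log T) = β * S := by
    rw [Real.sqrt_eq_iff_mul_self_eq (by positivity) (by positivity)]
    symm
    calc β * S * (β * S) = β ^ 2 * S ^ 2 := by ring
      _ = β * T * Real.log T := by rw [hS2]; field_simp
  have hW : T * Real.log T = β * S ^ 2 := by rw [hS2]; field_simp
  rw [hQ]
  refine ⟨by nlinarith, ?_, ?_⟩
  · rw [hW]
    have : β * S * (c₁ * S) ≤ β * S * τ := by gcongr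
    linarith
  -- Crudely τ ≤ max c₂ 1 · T; the constant's logarithm is then absorbed using log T ≥ log 2.
  · have hST : S ≤ T := by
      apply (pow_le_pow_iff_left₀ hS0.le (by positivity) two_ne_zero).1
      rw [hS2, div_le_iff₀ (by positivity)]
      have h1 : Real.log T ≤ T := (Real.log_le_sub_one_of_pos (by linarith)).trans (by linarith)
      have h2 : (T : ℝ) * Real.log T ≤ T * T := by gcongr
      nlinarith [sq_nonneg (T : ℝ)]
    have hτT : (τ : ℝ) ≤ max c₂ 1 * T :=
      hτ₂.trans (mul_le_mul (le_max_left _ _) hST hS0.le (by positivity))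
    have hτ0 : (0 : ℝ) < τ := lt_of_lt_of_le (by positivity) hτ₁
    have h1 := Real.log_le_log hτ0 hτT
    rw [Real.log_mul (by positivity) (by positivity)] at h1
    have h2 : 0 ≤ Real.log (max c₂ 1) / Real.log 2 :=
      div_nonneg (Real.log_nonneg (le_max_right _ _)) hlog2.le
    have h3 := mul_le_mul_of_nonneg_left hlogT h2
    rw [div_mul_cancel₀ _ hlog2.ne'] at h3
    linarith

lemma suboptimalPulls_le {Ω : Type*} [MeasurableSpace Ω] {K : ℕ} (P : Measure Ω)
    (X : ℕ → Ω → Fin K → ℝ) (T : ℕ) (arm : ℕ → Ω → Fin K) (a : Fin K) (ω : Ω) :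
    suboptimalPulls P X T arm a ω ≤ T :=
  (Finset.card_filter_le _ _).trans (by simp)

lemma eventually_long_window {ξ : ℝ} (hξ : 0 < ξ) (N : ℕ) (C : ℝ) :
    ∃ τ₀ : ℕ, ∀ τ : ℕ, τ₀ ≤ τ → N ≤ τ ∧ C ≤ √(ξ * Real.log τ) ∧ 1 ≤ Real.log τ := by
  have hlog : Filter.Tendsto (fun τ : ℕ => Real.log τ) Filter.atTop Filter.atTop :=
    Real.tendsto_log_atTop.comp tendsto_natCast_atTop_atTop
  have hsqrt : Filter.Tendsto (fun τ : ℕ => √(ξ * Real.log τ)) Filter.atTop Filter.atTop :=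
    Real.tendsto_sqrt_atTop.comp (hlog.const_mul_atTop hξ)
  exact Filter.eventually_atTop.1 ((Filter.eventually_ge_atTop N).and
    ((hsqrt.eventually_ge_atTop C).and (hlog.eventually_ge_atTop 1)))

/-- The condition ξ > 1/2 is exactly what leaves room for a grid ratio above 1. -/
lemma exists_peeling_ratio {ξ : ℝ} (hξ : 1 / 2 < ξ) :
    ∃ q : ℝ, 1 < q ∧ 2 * ξ * (1 - (q - 1) ^ 2) = 1 := by
  have hpos : 0 < 1 - 1 / (2 * ξ) := by
    rw [sub_pos, div_lt_one (by linarith)]; linarith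
  refine ⟨1 + √(1 - 1 / (2 * ξ)), by linarith [Real.sqrt_pos.2 hpos], ?_⟩
  rw [add_sub_cancel_left, Real.sq_sqrt hpos.le]
  have : ξ ≠ 0 := by linarith
  field_simp
  ring

end IncentivizedBandit

/-! ### Choice of the constant and proof of the theorem -/

open IncentivizedBandit in
theorem theorem2 (K : ℕ) (ξ : ℝ) (hξ : 1 / 2 < ξ) (l : ℝ≥0) (Δ : ℝ) (hΔ : 0 < Δ)
    (c₁ c₂ : ℝ) (hc₁ : 0 < c₁) (hc : c₁ ≤ c₂) :
    ∃ η : ℝ, 0 < η ∧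
      ∀ (Ω : Type*) [m : MeasurableSpace Ω] (P : Measure Ω) [IsProbabilityMeasure P]
        (ℱ : Filtration ℕ m) (T τ β : ℕ) (f : ℕ → ℝ → ℝ) (X : ℕ → Ω → Fin K → ℝ)
        (arm greedy : ℕ → Ω → Fin K) (r : ℕ → Ω → ℝ),
        2 ≤ T →
        IsEnvironment P ℱ T X →
        IsDrift l T f →
        β = numBreakpoints P X T →
        1 ≤ β →
        c₁ * Real.sqrt (T * Real.log T / β) ≤ τ →
        τ ≤ c₂ * Real.sqrt (T * Real.log T / β) →
        (∀ t, 1 ≤ t → t ≤ T → Measurable[ℱ (t - 1)] (arm t)) →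
        (∀ ω, IsTrajectory ξ τ T f (fun t => X t ω) (fun t => arm t ω) (fun t => greedy t ω)
          (fun t => r t ω)) →
        (∀ a : Fin K, HasGap P X T Δ a →
          ∫ ω, (suboptimalPulls P X T arm a ω : ℝ) ∂P ≤ η * Real.sqrt (β * T * Real.log T)) ∧
        ((∀ a : Fin K, HasGap P X T Δ a) →
          ∫ ω, regret P X T arm ω ∂P ≤ η * Real.sqrt (β * T * Real.log T)) := by
  have hξ0 : 0 < ξ := by linarith
  have hl : (0 : ℝ) ≤ l := l.2
  have hc₂ : 0 < c₂ := hc₁.trans_le hc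
  obtain ⟨q, hq, hqξ⟩ := exists_peeling_ratio hξ
  have hlogq : 0 < Real.log q := Real.log_pos hq
  have hlog2 : 0 < Real.log 2 := Real.log_pos (by norm_num)
  obtain ⟨G, hG⟩ := exists_nat_ge ((4 * (4 * (l : ℝ) + 1)) ^ 2 + 1)
  set N := K * scarceCount G K K + 1 with hN
  obtain ⟨τ₀, hτ₀⟩ := eventually_long_window hξ0 (4 * N + K + 4)
    (max ((1 + l : ℝ) ^ K) (4 * √N))
  set CA := (4 * (4 * l + 1) ^ 2 * ξ + 2) / Δ ^ 2 with hCA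
  have hCA0 : 0 < CA := by positivity
  set C₃ := Real.log (max c₂ 1) / Real.log 2 + 1 with hC₃
  have hC₃0 : 0 < C₃ := by
    have : 0 ≤ Real.log (max c₂ 1) / Real.log 2 :=
      div_nonneg (Real.log_nonneg (le_max_right _ _)) hlog2.le
    linarith
  set η₁ := τ₀ / (c₁ * Real.log 2) + ((CA + 3) * c₂ + (CA + 3 + 1 / Real.log q) * C₃ / c₁)
    with hη₁
  have hη₁a : 0 ≤ τ₀ / (c₁ * Real.log 2) := by positivity
  have hη₁b : 0 < (CA + 3) * c₂ + (CA + 3 + 1 / Real.log q) * C₃ / c₁ := by positivity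
  have hη₁0 : 0 < η₁ := by linarith
  -- The factor K comes from summing over arms; the extra 1 covers a single arm and keeps the
  -- constant positive for K = 0.
  refine ⟨(K + 1) * η₁, by positivity, ?_⟩
  intro Ω m P _ ℱ T τ β f X arm greedy r hT hX hf hβ hβ1 hτ₁ hτ₂ harm htraj
  obtain ⟨hβτ, hTτ, hlogτ⟩ := window_estimates hc₁ hT hβ1 hτ₁ hτ₂
  set Q := √(β * T * Real.log T) with hQ
  have hQ0 : 0 ≤ Q := Real.sqrt_nonneg _
  have hT2 : (2 : ℝ) ≤ T := by exact_mod_cast hT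
  have hlogT : Real.log 2 ≤ Real.log T := Real.log_le_log (by norm_num) hT2
  have hpulls : ∀ a : Fin K, HasGap P X T Δ a →
      ∫ ω, (suboptimalPulls P X T arm a ω : ℝ) ∂P ≤ η₁ * Q := by
    intro a hgap
    -- A window below the constant τ₀ forces T log T = O(Q), so the trivial bound T is enough.
    rcases lt_or_ge τ τ₀ with hsmall | hlarge
    · have h1 : ∫ ω, (suboptimalPulls P X T arm a ω : ℝ) ∂P ≤ T := by
        have := integral_mono_of_nonneg (μ := P)
          (f := fun ω => (suboptimalPulls P X T arm a ω : ℝ)) (g := fun _ => (T : ℝ))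
          (ae_of_all _ fun ω => Nat.cast_nonneg _) (integrable_const _)
          (ae_of_all _ fun ω => Nat.cast_le.2 (suboptimalPulls_le P X T arm a ω))
        simpa using this
      have h2 : (T : ℝ) ≤ τ₀ / (c₁ * Real.log 2) * Q := by
        rw [div_mul_eq_mul_div, le_div_iff₀ (by positivity)]
        have h3 : (τ : ℝ) ≤ τ₀ := by exact_mod_cast hsmall.le
        calc T * (c₁ * Real.log 2) ≤ T * (c₁ * Real.log T) := by gcongr
          _ = c₁ * (T * Real.log T) := by ring
          _ ≤ Q * τ := hTτ
          _ ≤ Q * τ₀ := by gcongr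
          _ = τ₀ * Q := mul_comm _ _
      have h4 := mul_nonneg hη₁b.le hQ0
      rw [hη₁, add_mul]
      linarith
    · obtain ⟨hNτ, hL, hlog1⟩ := hτ₀ τ hlarge
      have hM := (le_max_left _ _).trans hL
      have hNL := (le_max_right _ _).trans hL
      have hdrop : ∀ ω s, K < s → s ≤ T → ∀ b,
          1 ≤ windowCount τ (fun s => arm s ω) s b := fun ω s hs hsT b =>
        (htraj ω).one_le_windowCount hf (fun t h1 hT b => hX.mem_Icc t h1 hT ω b) hξ0 hG hN hNτ hM
          hNL hs hsT b
      have hA := Nat.ceil_lt_add_one (a := CA * Real.log τ) (by positivity)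
      have hA' := Nat.le_ceil (CA * Real.log τ)
      have hmain := hX.integral_suboptimalPulls_le harm htraj hf hξ0 hq hqξ (by omega) (by omega)
        hM hdrop hΔ hA' hgap
      rw [← hβ] at hmain
      refine hmain.trans ?_
      set A := ⌈CA * Real.log τ⌉₊
      have hτ0 : (0 : ℝ) < τ := by exact_mod_cast (by omega : 0 < τ)
      have hfloor := Nat.floor_le (a := Real.log τ / Real.log q) (by positivity)
      set k := ⌊Real.log τ / Real.log q⌋₊
      have hβ1' : (1 : ℝ) ≤ β := by exact_mod_cast hβ1
      have hττ : (τ : ℝ) ≤ β * τ := le_mul_of_one_le_left hτ0.le hβ1'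
      have hA1 : (A : ℝ) ≤ (CA + 1) * Real.log τ := by linarith
      have hlogle : Real.log τ ≤ β * τ :=
        ((Real.log_le_sub_one_of_pos hτ0).trans (by linarith)).trans hττ
      have hTdiv : 0 ≤ (T : ℝ) / τ := by positivity
      have hk : (k : ℝ) + 2 ≤ (1 / Real.log q + 2) * Real.log τ := by
        rw [add_mul, one_div_mul_eq_div]; linarith
      have hlogTτ : Real.log τ * (T / τ) ≤ C₃ / c₁ * Q := by
        calc Real.log τ * (T / τ) ≤ C₃ * Real.log T * (T / τ) := by gcongr
          _ = C₃ / c₁ * (c₁ * (T * Real.log T) / τ) := by field_simp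
          _ ≤ C₃ / c₁ * Q := by
              gcongr
              rwa [div_le_iff₀ hτ0]
      have hAmul : (A : ℝ) * (T / τ + 1) ≤
          (CA + 1) * (Real.log τ * (T / τ)) + (CA + 1) * (β * τ) := by
        calc (A : ℝ) * (T / τ + 1) ≤ (CA + 1) * Real.log τ * (T / τ + 1) := by gcongr
          _ = (CA + 1) * (Real.log τ * (T / τ)) + (CA + 1) * Real.log τ := by ring
          _ ≤ _ := by gcongr
      have hkmul : (T : ℝ) * ((k + 2) / τ) ≤ (1 / Real.log q + 2) * (Real.log τ * (T / τ)) := by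
        calc (T : ℝ) * ((k + 2) / τ) = (k + 2) * (T / τ) := by ring
          _ ≤ (1 / Real.log q + 2) * Real.log τ * (T / τ) := by gcongr
          _ = _ := by ring
      calc (τ : ℝ) + β * τ + A * (T / τ + 1) + T * ((k + 2) / τ)
          ≤ (CA + 3) * (β * τ) + (CA + 3 + 1 / Real.log q) * (Real.log τ * (T / τ)) := by
            linarith
        _ ≤ (CA + 3) * (c₂ * Q) + (CA + 3 + 1 / Real.log q) * (C₃ / c₁ * Q) := by gcongr
        _ = ((CA + 3) * c₂ + (CA + 3 + 1 / Real.log q) * C₃ / c₁) * Q := by ring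
        _ ≤ η₁ * Q := by gcongr; linarith
  have hKη : 0 ≤ K * (η₁ * Q) := by positivity
  refine ⟨fun a hgap => (hpulls a hgap).trans ?_, fun hgap => ?_⟩
  · linarith
  · refine (hX.integral_regret_le harm).trans ?_
    have h1 := Finset.sum_le_card_nsmul Finset.univ
      (fun a => ∫ ω, (suboptimalPulls P X T arm a ω : ℝ) ∂P) _ fun a _ => hpulls a (hgap a)
    rw [Finset.card_univ, Fintype.card_fin, nsmul_eq_mul] at h1
    have := mul_nonneg hη₁0.le hQ0
    linarith
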